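/- Let $3\le p<5$, $\theta=\frac{4p-12}{(p-1)(7-p)}$ and $1-\frac{(5-p)(1-\theta)}{2(p+1)}<s<1$. Let $\eta$ be a smooth radial function on $\mathbb{R}^3$, nonincreasing in $|\xi|$, with $\eta(\xi)=1$ for $|\xi|\le 1$ and $\eta(\xi)=|\xi|^{-(1-s)}$ for $|\xi|\ge 2$. For a dyadic number $N=2^k$, $k\in\mathbb{N}$, let $I=I_N$ be the Fourier multiplier with symbol $\eta(\xi/N)$, and let $D$ be the Fourier multiplier with symbol $|\xi|$ (with $\hat f(\xi)=\int_{\mathbb{R}^3} f(x)e^{-ix\cdot\xi}\,dx$). Fix $\kappa>0$. For $m\in[0,1]$ call $(q,r)$ $m$-wave admissible if $2<q\le\infty$, $2\le r<\infty$, $\frac1q+\frac1r\le\frac12$, $\frac1q+\frac3r=\frac32-m$, and moreover $q>2+\kappa$ if $m=1$. For an interval $J\subset\mathbb{R}$ of length $|J|\in[0,\infty]$ and a function $w:\mathbb{R}\times\mathbb{R}^3\to\mathbb{C}$ with $w\in C(J;H^s(\mathbb{R}^3))$ and $\partial_t w\in C(J;H^{s-1}(\mathbb{R}^3))$ put $$Z(J,w)=\sup_{m\in[0,1]}\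 \sup_{(q,r)\ m\text{-wave admissible}}\Big(\|\partial_t D^{-m}Iw\|_{L^q_tL^r_x(J)}+\|D^{1-m}Iw\|_{L^q_tL^r_x(J)}\Big)\in[0,\infty].$$ Then for all sufficiently small $\varepsilon>0$ (that is, for all $0<\varepsilon<\varepsilon_0$ with some $\varepsilon_0=\varepsilon_0(p,s,\kappa,\eta)>0$) there is a constant $C=C(\varepsilon,p,s,\kappa,\eta)$ such that, for every dyadic $N=2^k$, $k\in\mathbb{N}$, every interval $J$ and every $w$ as above, $$\big\|\,I(|w|^{p-1}w)-|Iw|^{p-1}Iw\,\big\|_{L^1_tL^2_x(J)}\ \le\ C\,\frac{Z(J,w)^p\,|J|^{\varepsilon}}{N^{\frac{5-p}{2}-\varepsilon}}$$ (with the convention $0\cdot\infty=0$ on the right-hand side). -/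

import Mathlib

open MeasureTheory FourierTransform
open scoped SchwartzMap ENNReal NNReal ContDiff

noncomputable section

namespace RoughWave

/-- Euclidean space `ℝ³`. -/
abbrev R3 : Type := EuclideanSpace ℝ (Fin 3)

/-- The exponent `θ = (4p - 12) / ((p - 1)(7 - p))`. -/
def theta (p : ℝ) : ℝ := (4 * p - 12) / ((p - 1) * (7 - p))

/-- The regularity threshold `s_p = 1 - (5 - p)(1 - θ) / (2(p + 1))`. -/
def sThreshold (p : ℝ) : ℝ := 1 - (5 - p) * (1 - theta p) / (2 * (p + 1))

/-- The profile `η` of the multiplier `I`: smooth, radial and nonincreasing in `|ξ|`, equal to `1`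
for `|ξ| ≤ 1` and to `|ξ|^{-(1-s)}` for `|ξ| ≥ 2`. (The monotonicity field contains radiality.) -/
structure IsProfile (s : ℝ) (η : R3 → ℝ) : Prop where
  smooth : ContDiff ℝ ∞ η
  radial_antitone : ∀ ξ ζ : R3, ‖ξ‖ ≤ ‖ζ‖ → η ζ ≤ η ξ
  eq_one : ∀ ξ : R3, ‖ξ‖ ≤ 1 → η ξ = 1
  eq_rpow : ∀ ξ : R3, 2 ≤ ‖ξ‖ → η ξ = 1 / ‖ξ‖ ^ (1 - s)

/-- The symbol `m_N(ξ) = η(ξ / N)`. -/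
def symbolI (η : R3 → ℝ) (N : ℝ) (ξ : R3) : ℝ := η (N⁻¹ • ξ)

/-- The symbol `|ξ|^a m_N(ξ)` of `D^a I_N`. -/
def symbolDI (a : ℝ) (η : R3 → ℝ) (N : ℝ) (ξ : R3) : ℝ := ‖ξ‖ ^ a * symbolI η N ξ

/-- The tempered distribution `T` is (integration against) the function `h`. -/
def Represents (h : R3 → ℂ) (T : 𝓢'(R3, ℂ)) : Prop :=
  AEStronglyMeasurable h volume ∧
    ∀ φ : 𝓢(R3, ℂ), Integrable (fun x => φ x * h x) volume ∧ T φ = ∫ x, φ x * h x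

/-- `S = σ(D) T`: the Fourier transform of `T` is a function, and multiplying it by the symbol `σ`
gives the Fourier transform of `S`. Symbols are written in the frequency variable of the
normalization `∫ f(x) e^{-i x·ξ} dx`; Mathlib's transform is `∫ f(x) e^{-2πi x·ξ} dx`, which is the
reason for the factor `2π`. -/
def IsFourierMultiplier (σ : R3 → ℝ) (T S : 𝓢'(R3, ℂ)) : Prop :=
  ∃ h : R3 → ℂ, Represents h (𝓕 T) ∧
    Represents (fun ξ => (σ ((2 * Real.pi) • ξ) : ℂ) * h ξ) (𝓕 S)

/-- `σ(D) T` is the function `g`. -/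
def IsMultiplierFunction (σ : R3 → ℝ) (T : 𝓢'(R3, ℂ)) (g : R3 → ℂ) : Prop :=
  ∃ S : 𝓢'(R3, ℂ), IsFourierMultiplier σ T S ∧ Represents g S

/-- `‖σ(D) T‖_{L^r(ℝ³)}`, equal to `∞` if `σ(D) T` is not a function. (The function `g` is unique
up to null sets, so the infimum runs over at most one value.) -/
def multiplierNorm (σ : R3 → ℝ) (r : ℝ≥0∞) (T : 𝓢'(R3, ℂ)) : ℝ≥0∞ :=
  ⨅ (g : R3 → ℂ) (_ : IsMultiplierFunction σ T g), eLpNorm g r volume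

/-- The nonlinearity `F(z) = |z|^{p-1} z`. -/
def nonlin (p : ℝ) (z : ℂ) : ℂ := ((‖z‖ ^ (p - 1) : ℝ) : ℂ) * z

/-- `‖I(|f|^{p-1} f) - |If|^{p-1} If‖_{L²(ℝ³)}`, where `I` is the multiplier with symbol `σ`. Here
`a = I(|f|^{p-1} f)` and `b = If`, which are unique up to null sets; the value is `∞` if one of them
does not exist as a function. -/
def commutatorNorm (p : ℝ) (σ : R3 → ℝ) (f : Lp ℂ 2 (volume : Measure R3)) : ℝ≥0∞ :=
  ⨅ (a : R3 → ℂ) (b : R3 → ℂ)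
    (_ : ∃ T : 𝓢'(R3, ℂ), Represents (fun x => nonlin p (f x)) T ∧ IsMultiplierFunction σ T a)
    (_ : IsMultiplierFunction σ (f : 𝓢'(R3, ℂ)) b),
    eLpNorm (fun x => a x - nonlin p (b x)) 2 volume

/-- The norm `L^q_t L^r_x (J × ℝ³)` of `σ(D) u`. -/
def mixedNorm (J : Set ℝ) (q r : ℝ≥0∞) (σ : R3 → ℝ) (u : ℝ → 𝓢'(R3, ℂ)) : ℝ≥0∞ :=
  eLpNorm (fun t => multiplierNorm σ r (u t)) q (volume.restrict J)

/-- `(q, r)` is `m`-wave admissible: `q ∈ (2, ∞]`, `r ∈ [2, ∞)`, `1/q + 1/r ≤ 1/2`,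
`1/q + 3/r = 3/2 - m`, and `q > 2 + κ` if `m = 1`. -/
def IsWaveAdmissible (κ m : ℝ) (q r : ℝ≥0∞) : Prop :=
  2 < q ∧ 2 ≤ r ∧ r ≠ ⊤ ∧ q⁻¹ + r⁻¹ ≤ 2⁻¹ ∧
    (q⁻¹).toReal + 3 * (r⁻¹).toReal = 3 / 2 - m ∧
    (m = 1 → ENNReal.ofReal (2 + κ) < q)

/-- `Z_{m,s}(J, w)`; `w'` is the time derivative of `w`. -/
def Zm (κ : ℝ) (η : R3 → ℝ) (N m : ℝ) (J : Set ℝ) (w w' : ℝ → 𝓢'(R3, ℂ)) : ℝ≥0∞ :=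
  ⨆ (q : ℝ≥0∞) (r : ℝ≥0∞) (_ : IsWaveAdmissible κ m q r),
    mixedNorm J q r (symbolDI (-m) η N) w' + mixedNorm J q r (symbolDI (1 - m) η N) w

/-- `Z(J, w) = sup_{m ∈ [0,1]} Z_{m,s}(J, w)`. -/
def Z (κ : ℝ) (η : R3 → ℝ) (N : ℝ) (J : Set ℝ) (w w' : ℝ → 𝓢'(R3, ℂ)) : ℝ≥0∞ :=
  ⨆ m ∈ Set.Icc (0 : ℝ) 1, Zm κ η N m J w w'

/-- `w ∈ C(J; H^s)` with time derivative `w' ∈ C(J; H^{s-1})`, the derivative being taken in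
`H^{s-1}`. The Bessel potential of order `σ` is an isomorphism of `H^σ` onto `L²`. -/
def IsEnergyPath (s : ℝ) (J : Set ℝ) (w w' : ℝ → 𝓢'(R3, ℂ)) : Prop :=
  (∃ U : ℝ → Lp ℂ 2 (volume : Measure R3), ContinuousOn U J ∧
      ∀ t ∈ J, TemperedDistribution.besselPotential R3 ℂ s (w t) = (U t : 𝓢'(R3, ℂ))) ∧
  ∃ V V' : ℝ → Lp ℂ 2 (volume : Measure R3), ContinuousOn V' J ∧
      ∀ t ∈ J, TemperedDistribution.besselPotential R3 ℂ (s - 1) (w t) = (V t : 𝓢'(R3, ℂ)) ∧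
        TemperedDistribution.besselPotential R3 ℂ (s - 1) (w' t) = (V' t : 𝓢'(R3, ℂ)) ∧
        HasDerivWithinAt V (V' t) J t

end RoughWave

end

noncomputable section

namespace RoughWave

/-! Write F(z) = |z|^{p-1} z, fix a time and split f = w(t) as f = f_l + g, where f_l is a smooth
cutoff of f to |ξ| ≤ N. There η(ξ/N) = 1, so I f_l = f_l and I F(f) - F(If) = I(F(f) - F(f_l)) + (I
- 1)F(f_l) - (F(f_l + Ig) - F(f_l)). The two differences of nonlinearities are controlled by
‖f_l‖_∞^{p-1} ‖g‖_2 + ‖g‖_{2p}^p, and ‖g‖_2 ≲ N^{-1} ‖DIf‖_2. In the middle term |η(ξ/N) - 1| ≤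
|ξ|/N trades I - 1 for N^{-1}∇, and ‖∇F(f_l)‖_2 ≲ ‖f_l‖_∞^{p-1} ‖∇f_l‖_2
(`lintegral_fourier_gradient_le`, proved with translations instead of a chain rule). This is
`exists_commutatorNorm_le`.

Two frequency-localized bounds remain. Bernstein summed over the dyadic annuli below N gives ‖f_l‖_∞
≲ N^{3/r-b} ‖D^b If‖_r for b < 3/r (`exists_low_sup_bound`). Above N the symbol |ξ|^{-b}/η decays
like |ξ|^{-(b-(1-s))}, which gives ‖g‖_{2p} ≲ N^{-b} ‖D^b If‖_{2p} for b > 1 - s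
(`exists_high_bound`).

In time, DIf is taken in L^∞L², and Hölder puts |J|^ε in front of two wave admissible norms: for f_l
the pair 1/q = (1-ε)/(p-1), 1/r = α = 1/2 - 1/q with b = 2α, and for g the pair q = p/(1-ε), r = 2p
with b = ((5-p)/2 - ε)/p. Both terms then carry exactly N^{-((5-p)/2-ε)}. The regularity assumption
enters only through nonnegativity of s and b > 1 - s in the second case, that is p(1-s) < (5-p)/2 -
ε, which the threshold allows for small ε (`mul_one_sub_lt_of_threshold`). -/

/-- The Hilbert space `L²(ℝ³)`. -/
abbrev L2 : Type := Lp ℂ 2 (volume : Measure R3)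

/-! ### Fourier multipliers on L² and the distributions they represent -/

/-- `g = m(D) f` for `f, g ∈ L²`, the symbol being written in the variable of Mathlib's Fourier
transform. -/
def MulRel (m : R3 → ℂ) (f g : L2) : Prop :=
  (𝓕 g : L2) =ᵐ[volume] fun ξ => m ξ * (𝓕 f : L2) ξ

/-- The symbol `σ` in the variable of Mathlib's Fourier transform. -/
def sym (σ : R3 → ℝ) (ξ : R3) : ℂ := (σ ((2 * Real.pi) • ξ) : ℂ)

/-- A real test function as a complex Schwartz function. -/
def schwartzOfReal (g : R3 → ℝ) (hg : ContDiff ℝ ∞ g) (hc : HasCompactSupport g) : 𝓢(R3, ℂ) :=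
  HasCompactSupport.toSchwartzMap (f := Complex.ofRealCLM ∘ g) (hc.comp_left rfl) (by fun_prop)

theorem schwartzOfReal_apply (g : R3 → ℝ) (hg : ContDiff ℝ ∞ g) (hc : HasCompactSupport g)
    (x : R3) : schwartzOfReal g hg hc x = (g x : ℂ) := rfl

theorem Represents.locallyIntegrable {h : R3 → ℂ} {T : 𝓢'(R3, ℂ)} (H : Represents h T) :
    LocallyIntegrable h volume := by
  intro x
  let χ : ContDiffBump x := ⟨1, 2, one_pos, one_lt_two⟩
  have hi := (H.2 (schwartzOfReal χ χ.contDiff χ.hasCompactSupport)).1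
  refine ⟨Metric.closedBall x 1, Metric.closedBall_mem_nhds x one_pos, ?_⟩
  refine (hi.integrableOn (s := Metric.closedBall x 1)).congr_fun ?_ measurableSet_closedBall
  intro y hy
  have : χ y = 1 := χ.one_of_mem_closedBall hy
  simp [schwartzOfReal_apply, this]

/-- Real test functions already separate locally integrable functions. This uniqueness is what makes
the infimum in `multiplierNorm` range over a single value. -/
theorem Represents.ae_eq {h h' : R3 → ℂ} {T : 𝓢'(R3, ℂ)} (H : Represents h T)
    (H' : Represents h' T) : h =ᵐ[volume] h' := by
  refine ae_eq_of_integral_contDiff_smul_eq H.locallyIntegrable H'.locallyIntegrable ?_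
  intro g hg hgc
  have e1 := (H.2 (schwartzOfReal g hg hgc)).2
  have e2 := (H'.2 (schwartzOfReal g hg hgc)).2
  simpa [schwartzOfReal_apply] using e1.symm.trans e2

theorem Represents.congr {h h' : R3 → ℂ} {T : 𝓢'(R3, ℂ)} (H : Represents h T)
    (e : h =ᵐ[volume] h') : Represents h' T := by
  refine ⟨H.1.congr e, fun φ => ⟨(H.2 φ).1.congr ?_, ?_⟩⟩
  · filter_upwards [e] with x hx; simp [hx]
  · rw [(H.2 φ).2]
    refine integral_congr_ae ?_
    filter_upwards [e] with x hx; simp [hx]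

theorem represents_coe (f : L2) : Represents f (f : 𝓢'(R3, ℂ)) := by
  refine ⟨(Lp.memLp f).1, fun φ => ⟨?_, by simp⟩⟩
  exact ((φ.memLp 2 volume)).integrable_mul (Lp.memLp f)

theorem represents_fourier (f : L2) : Represents (𝓕 f : L2) (𝓕 (f : 𝓢'(R3, ℂ))) := by
  rw [Lp.fourier_toTemperedDistribution_eq]; exact represents_coe _

theorem MulRel.isMultiplierFunction {σ : R3 → ℝ} {f g : L2} (h : MulRel (sym σ) f g) :
    IsMultiplierFunction σ (f : 𝓢'(R3, ℂ)) g :=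
  ⟨g, ⟨_, represents_fourier f, (represents_fourier g).congr h⟩, represents_coe g⟩

theorem coe_eq_of_represents {T : 𝓢'(R3, ℂ)} {f : L2} (H : Represents f T) :
    T = (f : 𝓢'(R3, ℂ)) := by
  ext φ
  rw [(H.2 φ).2, ((represents_coe f).2 φ).2]

theorem MulRel.ae_eq_of_isMultiplierFunction {σ : R3 → ℝ} {f g : L2} {u : R3 → ℂ}
    (h : MulRel (sym σ) f g) (hu : IsMultiplierFunction σ (f : 𝓢'(R3, ℂ)) u) :
    u =ᵐ[volume] g := by
  obtain ⟨S, ⟨k, hk, hS⟩, hu⟩ := hu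
  have e1 := hk.ae_eq (represents_fourier f)
  have e2 : (fun ξ => (σ ((2 * Real.pi) • ξ) : ℂ) * k ξ) =ᵐ[volume] (𝓕 g : L2) := by
    filter_upwards [e1, h] with ξ h1 h2
    rw [h2, h1]; rfl
  have e3 := coe_eq_of_represents (hS.congr e2)
  rw [← Lp.fourier_toTemperedDistribution_eq] at e3
  have e4 : S = (g : 𝓢'(R3, ℂ)) := by
    have := congrArg (fun T : 𝓢'(R3, ℂ) => 𝓕⁻ T) e3
    simpa using this
  exact hu.ae_eq (e4 ▸ represents_coe g)

/-- By uniqueness every competitor in the infimum equals `g` almost everywhere; this is how the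
norms inside `Z` come to control L² representatives. -/
theorem MulRel.eLpNorm_le_multiplierNorm {σ : R3 → ℝ} {f g : L2} (h : MulRel (sym σ) f g)
    (r : ℝ≥0∞) : eLpNorm g r volume ≤ multiplierNorm σ r (f : 𝓢'(R3, ℂ)) :=
  le_iInf₂ fun _ hu => (eLpNorm_congr_ae (h.ae_eq_of_isMultiplierFunction hu)).ge

/-- The Fourier multiplier with a bounded symbol, as an operator on `L²`. -/
def mulCLM (m : Lp ℂ ∞ (volume : Measure R3)) : L2 →L[ℂ] L2 :=
  (fourierInvCLM ℂ L2) ∘L ((ContinuousLinearMap.mul ℂ ℂ).holderL volume ∞ 2 2 m) ∘L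
    (fourierCLM ℂ L2)

theorem mulRel_mulCLM' (m : Lp ℂ ∞ (volume : Measure R3)) (f : L2) : MulRel m f (mulCLM m f) := by
  have : (𝓕 (mulCLM m f) : L2) = (ContinuousLinearMap.mul ℂ ℂ).holder 2 m (𝓕 f : L2) := by
    simp [mulCLM]
  unfold MulRel
  rw [this]
  filter_upwards [(ContinuousLinearMap.mul ℂ ℂ).coeFn_holder (r := 2) m (𝓕 f : L2)] with ξ h
  rw [h]; simp

theorem mulRel_mulCLM {m : R3 → ℂ} (hm : MemLp m ∞ volume) (f : L2) :
    MulRel m f (mulCLM (hm.toLp m) f) := by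
  filter_upwards [mulRel_mulCLM' (hm.toLp m) f, hm.coeFn_toLp] with ξ h1 h2
  rw [h1, h2]

theorem memLp_top_sym {σ : R3 → ℝ} (hσ : Measurable σ) {c : ℝ} (hc : ∀ ξ, |σ ξ| ≤ c) :
    MemLp (sym σ) ∞ (volume : Measure R3) := by
  refine memLp_top_of_bound (C := c) ?_ (Filter.Eventually.of_forall fun ξ => ?_)
  · unfold sym
    exact (Complex.measurable_ofReal.comp
      (hσ.comp (measurable_const_smul _))).aestronglyMeasurable
  · simpa [sym] using hc _

theorem exists_mulRel {σ : R3 → ℝ} (hσ : Measurable σ) {c : ℝ} (hc : ∀ ξ, |σ ξ| ≤ c) (f : L2) :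
    ∃ g, MulRel (sym σ) f g := ⟨_, mulRel_mulCLM (memLp_top_sym hσ hc) f⟩

theorem fourier_injective {f g : L2} (h : (𝓕 f : L2) =ᵐ[volume] (𝓕 g : L2)) : f = g :=
  (Lp.fourierTransformₗᵢ R3 ℂ).injective (Lp.ext h)

theorem MulRel.unique {m : R3 → ℂ} {f g g' : L2} (h : MulRel m f g) (h' : MulRel m f g') :
    g = g' := fourier_injective (h.trans h'.symm)

theorem MulRel.congr {m m' : R3 → ℂ} {f g : L2} (h : MulRel m f g) (e : ∀ᵐ ξ, m ξ = m' ξ) :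
    MulRel m' f g := by
  filter_upwards [h, e] with ξ h1 h2
  rw [h1, h2]

theorem MulRel.comp {m m' : R3 → ℂ} {f g k : L2} (h : MulRel m f g) (h' : MulRel m' g k) :
    MulRel (fun ξ => m' ξ * m ξ) f k := by
  filter_upwards [h, h'] with ξ h1 h2
  rw [h2, h1, mul_assoc]

theorem mulRel_one (f : L2) : MulRel (fun _ => 1) f f := by
  filter_upwards with ξ; simp

theorem MulRel.add {m m' : R3 → ℂ} {f g k : L2} (h : MulRel m f g) (h' : MulRel m' f k) :
    MulRel (fun ξ => m ξ + m' ξ) f (g + k) := by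
  have := Lp.coeFn_add (𝓕 g : L2) (𝓕 k : L2)
  unfold MulRel
  rw [FourierAdd.fourier_add]
  filter_upwards [this, h, h'] with ξ h1 h2 h3
  rw [h1, Pi.add_apply, h2, h3, add_mul]

theorem fourier_sub_L2 (f g : L2) : (𝓕 (f - g) : L2) = 𝓕 f - 𝓕 g :=
  (Lp.fourierTransformₗᵢ R3 ℂ).map_sub f g

theorem MulRel.sub {m m' : R3 → ℂ} {f g k : L2} (h : MulRel m f g) (h' : MulRel m' f k) :
    MulRel (fun ξ => m ξ - m' ξ) f (g - k) := by
  have := Lp.coeFn_sub (𝓕 g : L2) (𝓕 k : L2)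
  unfold MulRel
  rw [fourier_sub_L2]
  filter_upwards [this, h, h'] with ξ h1 h2 h3
  rw [h1, Pi.sub_apply, h2, h3, sub_mul]

theorem MulRel.sub_left {m : R3 → ℂ} {f f' g g' : L2} (h : MulRel m f g) (h' : MulRel m f' g') :
    MulRel m (f - f') (g - g') := by
  have e1 := Lp.coeFn_sub (𝓕 g : L2) (𝓕 g' : L2)
  have e2 := Lp.coeFn_sub (𝓕 f : L2) (𝓕 f' : L2)
  unfold MulRel
  rw [fourier_sub_L2, fourier_sub_L2]
  filter_upwards [e1, e2, h, h'] with ξ h1 h2 h3 h4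
  rw [h1, h2, Pi.sub_apply, Pi.sub_apply, h3, h4, mul_sub]

theorem mulRel_zero (f : L2) : MulRel (fun _ => 0) f 0 := by
  have := (mulRel_one f).sub (mulRel_one f)
  simpa using this

theorem MulRel.sum {m : ℕ → R3 → ℂ} {f : L2} {g : ℕ → L2} (h : ∀ j, MulRel (m j) f (g j))
    (n : ℕ) : MulRel (fun ξ => ∑ j ∈ Finset.range n, m j ξ) f (∑ j ∈ Finset.range n, g j) := by
  induction n with
  | zero => simpa using mulRel_zero f
  | succ n ih => simpa only [Finset.sum_range_succ] using ih.add (h n)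

theorem enorm_fourier (f : L2) : eLpNorm (𝓕 f : L2) 2 volume = eLpNorm f 2 volume := by
  rw [← Lp.enorm_def, ← Lp.enorm_def, enorm_eq_iff_norm_eq]
  exact Lp.norm_fourier_eq f

theorem MulRel.eLpNorm_le {m m' : R3 → ℂ} {f g k : L2} (h : MulRel m f g) (h' : MulRel m' f k)
    {c : ℝ} (hc : ∀ ξ, ‖m ξ‖ ≤ c * ‖m' ξ‖) :
    eLpNorm g 2 volume ≤ ENNReal.ofReal c * eLpNorm k 2 volume := by
  rw [← enorm_fourier g, ← enorm_fourier k]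
  refine eLpNorm_le_mul_eLpNorm_of_ae_le_mul ?_ 2
  filter_upwards [h, h'] with ξ h1 h2
  rw [h1, h2, norm_mul, norm_mul, ← mul_assoc]
  exact mul_le_mul_of_nonneg_right (hc ξ) (norm_nonneg _)

theorem exists_subseq_ae_tendsto {u : ℕ → L2} {v : L2} (h : Filter.Tendsto u Filter.atTop (nhds v)) :
    ∃ ns : ℕ → ℕ, StrictMono ns ∧
      ∀ᵐ x, Filter.Tendsto (fun i => u (ns i) x) Filter.atTop (nhds (v x)) :=
  (tendstoInMeasure_of_tendsto_Lp h).exists_seq_tendsto_ae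

/-- Fatou along an almost everywhere convergent subsequence. It lets L^r bounds survive limits that
are only taken in L². -/
theorem eLpNorm_le_of_tendsto {u : ℕ → L2} {v : L2}
    (h : Filter.Tendsto u Filter.atTop (nhds v)) {r C : ℝ≥0∞}
    (hC : ∀ n, eLpNorm (u n) r volume ≤ C) : eLpNorm v r volume ≤ C := by
  obtain ⟨ns, -, hns⟩ := exists_subseq_ae_tendsto h
  refine (Lp.eLpNorm_lim_le_liminf_eLpNorm (fun n => (Lp.memLp (u (ns n))).1) _ hns).trans ?_
  exact Filter.liminf_le_of_le (by isBoundedDefault) fun b hb =>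
    let ⟨n, hn⟩ := hb.exists; hn.trans (hC _)

theorem lowerSemicontinuous_eLpNorm (r : ℝ≥0∞) :
    LowerSemicontinuous fun u : L2 => eLpNorm u r volume := by
  rw [lowerSemicontinuous_iff_isClosed_preimage]
  intro C
  refine isSeqClosed_iff_isClosed.1 fun u v hu huv => ?_
  exact eLpNorm_le_of_tendsto huv hu

/-! ### Convolution inequalities and Bernstein -/

theorem enorm_integral_conv_le {k u : R3 → ℂ} (hk : AEStronglyMeasurable k volume)
    (hu : AEStronglyMeasurable u volume) (s r : ℝ≥0∞) [s.HolderTriple r 1] (x : R3) :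
    ‖∫ y, k y * u (x - y)‖ₑ ≤ eLpNorm k s volume * eLpNorm u r volume := by
  have hmp := Measure.measurePreserving_sub_left (volume : Measure R3) x
  have e1 : eLpNorm (k • (u ∘ fun y => x - y)) 1 volume ≤
      eLpNorm k s volume * eLpNorm (u ∘ fun y => x - y) r volume :=
    eLpNorm_smul_le_mul_eLpNorm (hu.comp_measurePreserving hmp) hk
  have e2 : eLpNorm (u ∘ fun y => x - y) r volume = eLpNorm u r volume :=
    eLpNorm_comp_measurePreserving hu hmp
  have e3 : eLpNorm (k • (u ∘ fun y => x - y)) 1 volume = ∫⁻ y, ‖k y * u (x - y)‖ₑ :=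
    eLpNorm_one_eq_lintegral_enorm
  rw [e2, e3] at e1
  exact (enorm_integral_le_lintegral_enorm _).trans e1

/-- Hölder applied to k v = k^{1/r'} · (k^{1/r} v), the pointwise step of Young's inequality with an
L¹ kernel. -/
theorem lintegral_mul_rpow_le {μ : Measure R3} {k v : R3 → ℝ≥0∞} (hk : Measurable k)
    (hv : Measurable v) {r r' : ℝ} (hc : r.HolderConjugate r') :
    (∫⁻ y, k y * v y ∂μ) ^ r ≤ (∫⁻ y, k y ∂μ) ^ (r / r') * ∫⁻ y, k y * v y ^ r ∂μ := by
  have hr0 : 0 < r := hc.pos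
  have hr'0 : 0 < r' := hc.symm.pos
  have hsum : 1 / r' + 1 / r = 1 := by
    have := hc.inv_add_inv_eq_one; rw [one_div, one_div, add_comm]; exact this
  have e : ∫⁻ y, k y * v y ∂μ ≤ (∫⁻ y, k y ∂μ) ^ (1 / r') *
      (∫⁻ y, k y * v y ^ r ∂μ) ^ (1 / r) := by
    have := ENNReal.lintegral_mul_le_Lp_mul_Lq μ hc.symm
      (f := fun y => k y ^ (1 / r')) (g := fun y => k y ^ (1 / r) * v y)
      (by fun_prop) (by fun_prop)
    refine (le_of_eq ?_).trans (this.trans (le_of_eq ?_))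
    · refine lintegral_congr fun y => ?_
      rw [Pi.mul_apply, ← mul_assoc, ← ENNReal.rpow_add_of_nonneg _ _ (by positivity)
        (by positivity), hsum, ENNReal.rpow_one]
    · congr 2
      · refine lintegral_congr fun y => ?_
        rw [← ENNReal.rpow_mul, one_div, inv_mul_cancel₀ hr'0.ne', ENNReal.rpow_one]
      · refine lintegral_congr fun y => ?_
        rw [ENNReal.mul_rpow_of_nonneg _ _ hr0.le, ← ENNReal.rpow_mul, one_div,
          inv_mul_cancel₀ hr0.ne', ENNReal.rpow_one]
  refine (ENNReal.rpow_le_rpow e hr0.le).trans (le_of_eq ?_)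
  rw [ENNReal.mul_rpow_of_nonneg _ _ hr0.le, ← ENNReal.rpow_mul, ← ENNReal.rpow_mul, one_div,
    one_div, inv_mul_cancel₀ hr0.ne', ENNReal.rpow_one, inv_mul_eq_div]

theorem lintegral_conv_rpow_le {k u : R3 → ℂ} (hk : Measurable k) (hu : Measurable u) {r r' : ℝ}
    (hc : r.HolderConjugate r') :
    ∫⁻ x, ‖∫ y, k y * u (x - y)‖ₑ ^ r ≤ (∫⁻ x, ‖k x‖ₑ) ^ r * ∫⁻ x, ‖u x‖ₑ ^ r := by
  have hr0 : 0 < r := hc.pos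
  have hr'0 : 0 < r' := hc.symm.pos
  generalize hK : ∫⁻ x, ‖k x‖ₑ = K
  have key : ∀ x, ‖∫ y, k y * u (x - y)‖ₑ ^ r ≤
      K ^ (r / r') * ∫⁻ y, ‖k y‖ₑ * ‖u (x - y)‖ₑ ^ r := by
    intro x
    refine (ENNReal.rpow_le_rpow (enorm_integral_le_lintegral_enorm _) hr0.le).trans ?_
    simp_rw [enorm_mul]
    rw [← hK]
    exact lintegral_mul_rpow_le (k := fun y => ‖k y‖ₑ) (v := fun y => ‖u (x - y)‖ₑ)
      (by fun_prop) (by fun_prop) hc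
  have hm : Measurable fun z : R3 × R3 => ‖k z.2‖ₑ * ‖u (z.1 - z.2)‖ₑ ^ r := by fun_prop
  have inner : ∀ y, ∫⁻ x, ‖k y‖ₑ * ‖u (x - y)‖ₑ ^ r = ‖k y‖ₑ * ∫⁻ x, ‖u x‖ₑ ^ r := by
    intro y
    rw [lintegral_const_mul _ (by fun_prop), lintegral_sub_right_eq_self (fun x => ‖u x‖ₑ ^ r) y]
  have hexp : K ^ (r / r') * K = K ^ r := by
    nth_rewrite 2 [← ENNReal.rpow_one K]
    rw [← ENNReal.rpow_add_of_nonneg _ _ (by positivity) zero_le_one]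
    congr 1
    have := hc.inv_add_inv_eq_one
    field_simp at this
    field_simp
    linarith
  calc _ ≤ ∫⁻ x, K ^ (r / r') * ∫⁻ y, ‖k y‖ₑ * ‖u (x - y)‖ₑ ^ r := lintegral_mono key
    _ = K ^ (r / r') * ∫⁻ x, ∫⁻ y, ‖k y‖ₑ * ‖u (x - y)‖ₑ ^ r :=
      lintegral_const_mul _ hm.lintegral_prod_right'
    _ = K ^ (r / r') * ∫⁻ y, ∫⁻ x, ‖k y‖ₑ * ‖u (x - y)‖ₑ ^ r := by
      rw [lintegral_lintegral_swap hm.aemeasurable]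
    _ = K ^ (r / r') * ∫⁻ y, ‖k y‖ₑ * ∫⁻ x, ‖u x‖ₑ ^ r := by simp_rw [inner]
    _ = K ^ r * ∫⁻ x, ‖u x‖ₑ ^ r := by
      rw [lintegral_mul_const _ (by fun_prop), ← mul_assoc, hK, hexp]

theorem eLpNorm_conv_le {k u : R3 → ℂ} (hk : Measurable k) (hu : Measurable u) {r : ℝ}
    (hr : 1 < r) :
    eLpNorm (fun x => ∫ y, k y * u (x - y)) (ENNReal.ofReal r) volume ≤
      eLpNorm k 1 volume * eLpNorm u (ENNReal.ofReal r) volume := by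
  have hr0 : 0 < r := by linarith
  have h1 : (ENNReal.ofReal r) ≠ 0 := by simpa using hr0
  rw [eLpNorm_eq_lintegral_rpow_enorm_toReal h1 ENNReal.ofReal_ne_top,
    eLpNorm_eq_lintegral_rpow_enorm_toReal h1 ENNReal.ofReal_ne_top,
    eLpNorm_one_eq_lintegral_enorm, ENNReal.toReal_ofReal hr0.le]
  refine (ENNReal.rpow_le_rpow (lintegral_conv_rpow_le hk hu
    (Real.HolderConjugate.conjExponent hr)) (by positivity)).trans (le_of_eq ?_)
  rw [ENNReal.mul_rpow_of_nonneg _ _ (by positivity), ← ENNReal.rpow_mul, mul_one_div,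
    div_self hr0.ne', ENNReal.rpow_one]

theorem mulRel_toLp_convolution (k φ : 𝓢(R3, ℂ)) :
    MulRel (𝓕 k : 𝓢(R3, ℂ)) (φ.toLp 2)
      ((SchwartzMap.convolution (ContinuousLinearMap.mul ℂ ℂ) k φ).toLp 2) := by
  unfold MulRel
  rw [SchwartzMap.toLp_fourier_eq, SchwartzMap.toLp_fourier_eq, SchwartzMap.fourier_convolution]
  filter_upwards [SchwartzMap.coeFn_toLp (SchwartzMap.pairing (ContinuousLinearMap.mul ℂ ℂ) (𝓕 k)
    (𝓕 φ)) 2 volume, SchwartzMap.coeFn_toLp (𝓕 φ) 2 volume] with ξ h1 h2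
  rw [h1, h2]; simp

/-- For Schwartz `f` this is the convolution theorem. In general approximate `f` in L²: the
multiplier side converges almost everywhere along a subsequence, and since the kernel is itself in
L², Cauchy–Schwarz makes the convolutions converge at every point. -/
theorem MulRel.ae_eq_conv {k : 𝓢(R3, ℂ)} {f g : L2} (h : MulRel (𝓕 k : 𝓢(R3, ℂ)) f g) :
    g =ᵐ[volume] fun x => ∫ y, k y * f (x - y) := by
  have hd := (SchwartzMap.denseRange_toLpCLM (E := R3) (F := ℂ) (p := 2) (μ := volume)
    ENNReal.ofNat_ne_top) f
  obtain ⟨v, hv, hvf⟩ := mem_closure_iff_seq_limit.1 hd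
  choose φ hφ using hv
  have hφ' : ∀ n, (φ n).toLp 2 volume = v n := hφ
  let m := ((𝓕 k : 𝓢(R3, ℂ)).memLp_top volume)
  have hg : g = mulCLM (m.toLp _) f := h.unique (mulRel_mulCLM m f)
  have hT : ∀ n, mulCLM (m.toLp _) (v n) =
      (SchwartzMap.convolution (ContinuousLinearMap.mul ℂ ℂ) k (φ n)).toLp 2 := fun n => by
    rw [← hφ']
    exact (mulRel_mulCLM m _).unique (mulRel_toLp_convolution k (φ n))
  have hlim : Filter.Tendsto (fun n => mulCLM (m.toLp _) (v n)) Filter.atTop (nhds g) := by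
    rw [hg]; exact ((mulCLM (m.toLp _)).continuous.tendsto f).comp hvf
  obtain ⟨ns, hns, hae⟩ := exists_subseq_ae_tendsto hlim
  have hae2 : ∀ᵐ x, ∀ n, mulCLM (m.toLp _) (v n) x = ∫ y, k y * φ n (x - y) := by
    rw [ae_all_iff]; intro n
    rw [hT]
    filter_upwards [SchwartzMap.coeFn_toLp
      (SchwartzMap.convolution (ContinuousLinearMap.mul ℂ ℂ) k (φ n)) 2 volume] with x hx
    rw [hx, SchwartzMap.convolution_apply]; rfl
  filter_upwards [hae, hae2] with x hx hx2
  refine tendsto_nhds_unique hx ?_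
  simp_rw [hx2]
  suffices H : Filter.Tendsto (fun n => ∫ y, k y * φ n (x - y)) Filter.atTop
      (nhds (∫ y, k y * f (x - y))) from H.comp hns.tendsto_atTop
  rw [tendsto_iff_edist_tendsto_0]
  have hb : ∀ n, edist (∫ y, k y * φ n (x - y)) (∫ y, k y * f (x - y)) ≤
      eLpNorm k 2 volume * edist (v n) f := by
    intro n
    have hmp := Measure.measurePreserving_sub_left (volume : Measure R3) x
    have i1 : Integrable (fun y => k y * φ n (x - y)) :=
      (k.memLp 2 volume).integrable_mul (((φ n).memLp 2 volume).comp_measurePreserving hmp)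
    have i2 : Integrable (fun y => k y * f (x - y)) :=
      (k.memLp 2 volume).integrable_mul ((Lp.memLp f).comp_measurePreserving hmp)
    rw [edist_eq_enorm_sub, ← integral_sub i1 i2]
    have : (fun y => k y * φ n (x - y) - k y * f (x - y)) =
        fun y => k y * (fun z => φ n z - f z) (x - y) := by ext y; ring
    rw [this]
    refine (enorm_integral_conv_le k.continuous.aestronglyMeasurable
      ((φ n).continuous.aestronglyMeasurable.sub (Lp.memLp f).1) 2 2 x).trans ?_
    rw [Lp.edist_def, ← hφ' n]
    gcongr
    refine (eLpNorm_congr_ae ?_).le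
    filter_upwards [SchwartzMap.coeFn_toLp (φ n) 2 volume] with z hz
    simp [hz]
  refine tendsto_of_tendsto_of_tendsto_of_le_of_le tendsto_const_nhds ?_ (fun _ => zero_le)
    hb
  have := ENNReal.Tendsto.const_mul (a := eLpNorm k 2 volume) (tendsto_iff_edist_tendsto_0.1 hvf)
    (Or.inr ((k.memLp 2 volume).2.ne))
  simpa using this

theorem eLpNorm_comp_smul {k : R3 → ℂ} (hk : Continuous k) {s : ℝ≥0∞} (hs : s ≠ ⊤) {M : ℝ}
    (hM : 0 < M) :
    eLpNorm (fun x => k (M • x)) s volume =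
      ENNReal.ofReal ((M ^ 3)⁻¹) ^ (1 / s).toReal * eLpNorm k s volume := by
  have h := eLpNorm_map_measure (p := s) (μ := (volume : Measure R3)) (f := fun x => M • x)
    (hk.aestronglyMeasurable (μ := Measure.map (fun x : R3 => M • x) volume))
    (measurable_const_smul M).aemeasurable
  have h2 : Measure.map (fun x : R3 => M • x) volume =
      (ENNReal.ofReal ((M ^ 3)⁻¹)) • (volume : Measure R3) := by
    have := Measure.map_addHaar_smul (volume : Measure R3) hM.ne'
    simp only [finrank_euclideanSpace, Fintype.card_fin] at this
    rw [abs_of_pos (by positivity)] at this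
    exact this
  have h3 : (fun x => k (M • x)) = k ∘ fun x => M • x := rfl
  rw [h3, ← h, h2, eLpNorm_smul_measure_of_ne_top hs, smul_eq_mul]

theorem fourierInv_comp_inv_smul (ρ : R3 → ℂ) {M : ℝ} (hM : 0 < M) (x : R3) :
    𝓕⁻ (fun ξ => ρ (M⁻¹ • ξ)) x = ((M ^ 3 : ℝ) : ℂ) * 𝓕⁻ ρ (M • x) := by
  rw [Real.fourierInv_eq', Real.fourierInv_eq']
  have h := Measure.integral_comp_smul (volume : Measure R3)
    (fun v => Complex.exp (↑(2 * Real.pi * inner ℝ v (M • x)) * Complex.I) • ρ v) M⁻¹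
  simp only [finrank_euclideanSpace, Fintype.card_fin] at h
  rw [inv_pow, inv_inv, abs_of_pos (by positivity)] at h
  rw [← Complex.real_smul, ← h]
  refine integral_congr_ae (Filter.Eventually.of_forall fun v => ?_)
  simp only [real_inner_smul_left, real_inner_smul_right]
  rw [mul_inv_cancel_left₀ hM.ne']

theorem measurable_coe_L2 (f : L2) : Measurable f := (Lp.stronglyMeasurable f).measurable

/-- Bernstein's inequalities for a compactly supported smooth symbol at frequency scale `M`. -/
theorem exists_bernstein {ρ : R3 → ℝ} (hρ : ContDiff ℝ ∞ ρ) (hc : HasCompactSupport ρ) {r : ℝ}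
    (hr : 1 < r) :
    ∃ C : ℝ≥0, ∀ M : ℝ, 0 < M → ∀ f g : L2, MulRel (sym fun ξ => ρ (M⁻¹ • ξ)) f g →
      eLpNorm g (ENNReal.ofReal r) volume ≤ C * eLpNorm f (ENNReal.ofReal r) volume ∧
      eLpNorm g ∞ volume ≤
        C * ENNReal.ofReal (M ^ (3 / r)) * eLpNorm f (ENNReal.ofReal r) volume := by
  have hr0 : 0 < r := by linarith
  have hcj : r.HolderConjugate (r.conjExponent) := Real.HolderConjugate.conjExponent hr
  generalize r.conjExponent = r' at hcj
  have hr'0 : 0 < r' := hcj.symm.pos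
  have hsm : ∀ c : ℝ, c ≠ 0 → ContDiff ℝ ∞ (fun ξ => ρ (c • ξ)) ∧
      HasCompactSupport (fun ξ => ρ (c • ξ)) := fun c hc0 =>
    ⟨hρ.comp (contDiff_const_smul c), hc.comp_smul hc0⟩
  let k (c : ℝ) (hc0 : c ≠ 0) : 𝓢(R3, ℂ) := 𝓕⁻ (schwartzOfReal _ (hsm c hc0).1 (hsm c hc0).2)
  have h2pi : (2 * Real.pi) ≠ 0 := by positivity
  let k₀ := k _ h2pi
  let C : ℝ≥0 := (eLpNorm k₀ 1 volume).toNNReal + (eLpNorm k₀ (ENNReal.ofReal r') volume).toNNReal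
  have hC1 : eLpNorm k₀ 1 volume ≤ C := by
    rw [← ENNReal.coe_toNNReal (k₀.memLp 1 volume).2.ne]
    exact ENNReal.coe_le_coe.2 le_self_add
  have hC2 : eLpNorm k₀ (ENNReal.ofReal r') volume ≤ C := by
    rw [← ENNReal.coe_toNNReal (k₀.memLp (ENNReal.ofReal r') volume).2.ne]
    exact ENNReal.coe_le_coe.2 le_add_self
  refine ⟨C, fun M hM f g h => ?_⟩
  have hcM : M⁻¹ * (2 * Real.pi) ≠ 0 := by positivity
  -- The kernel at scale M is M³ k₀(M·): its L¹ norm does not depend on M, and its L^{r'} norm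
  -- scales as M^{3-3/r'} = M^{3/r}.
  have hMk : ∀ x, k _ hcM x = ((M ^ 3 : ℝ) : ℂ) * k₀ (M • x) := by
    intro x
    have := fourierInv_comp_inv_smul (fun ξ => ((ρ ((2 * Real.pi) • ξ) : ℝ) : ℂ)) hM x
    simp only [k₀, k, SchwartzMap.fourierInv_coe]
    rw [show (⇑(schwartzOfReal _ (hsm _ h2pi).1 (hsm _ h2pi).2) : R3 → ℂ) =
      fun ξ => ((ρ ((2 * Real.pi) • ξ) : ℝ) : ℂ) from rfl, ← this]
    refine congrFun (congrArg _ (funext fun ξ => ?_)) x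
    simp [schwartzOfReal_apply, smul_smul, mul_comm]
  have hnorm : ∀ s : ℝ≥0∞, s ≠ ⊤ → eLpNorm (k _ hcM) s volume =
      ENNReal.ofReal (M ^ 3) * ENNReal.ofReal ((M ^ 3)⁻¹) ^ (1 / s).toReal *
        eLpNorm k₀ s volume := by
    intro s hs
    have e1 : (k _ hcM : R3 → ℂ) = ((M ^ 3 : ℝ) : ℂ) • fun x => k₀ (M • x) := by
      ext x; exact hMk x
    rw [e1, eLpNorm_const_smul, eLpNorm_comp_smul k₀.continuous hs hM, mul_assoc]
    congr 1
    rw [← ofReal_norm, Complex.norm_real, Real.norm_of_nonneg (by positivity)]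
  have hrel : MulRel (𝓕 (k _ hcM) : 𝓢(R3, ℂ)) f g := by
    refine h.congr (Filter.Eventually.of_forall fun ξ => ?_)
    simp [k, sym, schwartzOfReal_apply, smul_smul]
  have hg := hrel.ae_eq_conv
  rw [eLpNorm_congr_ae hg, eLpNorm_congr_ae hg]
  constructor
  · refine (eLpNorm_conv_le (k _ hcM).continuous.measurable (measurable_coe_L2 f) hr).trans ?_
    gcongr
    rw [hnorm 1 ENNReal.one_ne_top]
    refine le_trans (le_of_eq ?_) hC1
    rw [div_one, ENNReal.toReal_one, ENNReal.rpow_one, ← ENNReal.ofReal_mul (by positivity),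
      mul_inv_cancel₀ (by positivity), ENNReal.ofReal_one, one_mul]
  · have : (ENNReal.ofReal r').HolderTriple (ENNReal.ofReal r) 1 := by
      constructor
      rw [← ENNReal.ofReal_inv_of_pos hr'0, ← ENNReal.ofReal_inv_of_pos hr0,
        ← ENNReal.ofReal_add (by positivity) (by positivity), add_comm,
        hcj.inv_add_inv_eq_one]
      simp
    refine eLpNormEssSup_le_of_ae_enorm_bound (Filter.Eventually.of_forall fun x => ?_)
    refine (enorm_integral_conv_le (k _ hcM).continuous.aestronglyMeasurable (Lp.memLp f).1
      (ENNReal.ofReal r') (ENNReal.ofReal r) x).trans ?_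
    gcongr
    rw [hnorm _ ENNReal.ofReal_ne_top, mul_comm]
    refine mul_le_mul' hC2 (le_of_eq ?_)
    rw [one_div, ENNReal.toReal_inv, ENNReal.toReal_ofReal hr'0.le,
      ENNReal.ofReal_rpow_of_pos (by positivity), ← ENNReal.ofReal_mul (by positivity)]
    congr 1
    rw [← Real.rpow_natCast, ← Real.rpow_neg hM.le, ← Real.rpow_mul hM.le, ← Real.rpow_add hM]
    congr 1
    have := hcj.inv_add_inv_eq_one
    push_cast
    rw [show r'⁻¹ = 1 - r⁻¹ by linarith]
    ring

/-! ### Summing pieces of a multiplier -/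

/-- Plancherel and dominated convergence on the Fourier side, with dominating function c²|f̂|². -/
theorem tendsto_of_mulRel {m : ℕ → R3 → ℂ} {m' : R3 → ℂ} {f g : L2} {u : ℕ → L2}
    (hu : ∀ n, MulRel (m n) f (u n)) (hg : MulRel m' f g) {c : ℝ}
    (hc : ∀ n ξ, ‖m n ξ - m' ξ‖ ≤ c)
    (hlim : ∀ᵐ ξ, Filter.Tendsto (fun n => m n ξ) Filter.atTop (nhds (m' ξ))) :
    Filter.Tendsto u Filter.atTop (nhds g) := by
  have h0 : (2 : ℝ≥0∞) ≠ 0 := two_ne_zero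
  have hsub : ∀ n, edist (u n) g ^ (2 : ℝ) =
      ∫⁻ ξ, (‖(m n ξ - m' ξ) * (𝓕 f : L2) ξ‖ₑ) ^ (2 : ℝ) := by
    intro n
    rw [edist_eq_enorm_sub, Lp.enorm_def, ← enorm_fourier,
      eLpNorm_eq_lintegral_rpow_enorm_toReal h0 ENNReal.ofNat_ne_top, ← ENNReal.rpow_mul]
    simp only [ENNReal.toReal_ofNat]
    norm_num
    refine lintegral_congr_ae ?_
    filter_upwards [(hu n).sub hg] with ξ h
    rw [h, enorm_mul]
  have hf : ∫⁻ ξ, ‖(𝓕 f : L2) ξ‖ₑ ^ (2 : ℝ) ≠ ⊤ := by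
    have := (lintegral_rpow_enorm_lt_top_of_eLpNorm_lt_top h0 ENNReal.ofNat_ne_top
      (Lp.memLp (𝓕 f : L2)).2).ne
    simpa using this
  have key : Filter.Tendsto (fun n => edist (u n) g ^ (2 : ℝ)) Filter.atTop (nhds 0) := by
    simp_rw [hsub]
    rw [← lintegral_zero (μ := (volume : Measure R3))]
    refine tendsto_lintegral_of_dominated_convergence'
      (fun ξ => (ENNReal.ofReal c) ^ (2 : ℝ) * ‖(𝓕 f : L2) ξ‖ₑ ^ (2 : ℝ)) ?_ ?_ ?_ ?_
    · intro n
      have : AEStronglyMeasurable (𝓕 (u n - g) : L2) volume := (Lp.memLp _).1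
      exact (((this.congr ((hu n).sub hg))).enorm.pow_const _)
    · intro n
      refine Filter.Eventually.of_forall fun ξ => ?_
      beta_reduce
      rw [← ENNReal.mul_rpow_of_nonneg _ _ zero_le_two, enorm_mul]
      gcongr
      rw [← ofReal_norm]
      exact ENNReal.ofReal_le_ofReal (hc n ξ)
    · rw [lintegral_const_mul' _ _ (ENNReal.rpow_ne_top_of_nonneg zero_le_two
        ENNReal.ofReal_ne_top)]
      exact ENNReal.mul_ne_top (ENNReal.rpow_ne_top_of_nonneg zero_le_two
        ENNReal.ofReal_ne_top) hf
    · filter_upwards [hlim] with ξ h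
      have h1 : Filter.Tendsto (fun n => (m n ξ - m' ξ) * (𝓕 f : L2) ξ) Filter.atTop (nhds 0) := by
        have := (h.sub_const (m' ξ)).mul_const ((𝓕 f : L2) ξ)
        simpa using this
      have h2 := (ENNReal.continuous_rpow_const (y := 2)).tendsto _ |>.comp
        ((continuous_enorm.tendsto _).comp h1)
      simpa [Function.comp_def] using h2
  rw [tendsto_iff_edist_tendsto_0]
  have := (ENNReal.continuous_rpow_const (y := 1 / 2)).tendsto _ |>.comp key
  simp only [Function.comp_def, ← ENNReal.rpow_mul] at this
  simpa using this

/-- Summing pieces of a multiplier in `L^r`. -/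
theorem eLpNorm_le_tsum {m : ℕ → R3 → ℂ} {m' : R3 → ℂ} {f g : L2} {u : ℕ → L2}
    (hu : ∀ n, MulRel (m n) f (u n)) (hg : MulRel m' f g) {c : ℝ}
    (hc : ∀ n ξ, ‖∑ j ∈ Finset.range n, m j ξ - m' ξ‖ ≤ c)
    (hlim : ∀ᵐ ξ, Filter.Tendsto (fun n => ∑ j ∈ Finset.range n, m j ξ) Filter.atTop
      (nhds (m' ξ))) {r : ℝ≥0∞} (hr : 1 ≤ r) {B : ℕ → ℝ≥0∞}
    (hB : ∀ j, eLpNorm (u j) r volume ≤ B j) : eLpNorm g r volume ≤ ∑' j, B j := by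
  refine eLpNorm_le_of_tendsto (tendsto_of_mulRel (fun n => MulRel.sum hu n) hg hc hlim)
    fun n => ?_
  have e : ((∑ j ∈ Finset.range n, u j : L2) : R3 → ℂ) =ᵐ[volume] ∑ j ∈ Finset.range n, ⇑(u j) := by
    induction n with
    | zero => simpa using Lp.coeFn_zero ℂ 2 (volume : Measure R3)
    | succ n ih =>
      rw [Finset.sum_range_succ, Finset.sum_range_succ]
      filter_upwards [Lp.coeFn_add (∑ j ∈ Finset.range n, u j) (u n), ih] with x h1 h2
      rw [h1, Pi.add_apply, Pi.add_apply, h2]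
  rw [eLpNorm_congr_ae e]
  refine (eLpNorm_sum_le (fun j _ => (Lp.memLp (u j)).1) hr).trans ?_
  exact (Finset.sum_le_sum fun j _ => hB j).trans (ENNReal.sum_le_tsum _)

theorem MulRel.of_factor {m m' m'' : R3 → ℂ} {f F g : L2} (h : MulRel m f F)
    (h' : MulRel m'' f g) (e : ∀ ξ, m'' ξ = m' ξ * m ξ) : MulRel m' F g := by
  filter_upwards [h, h'] with ξ h1 h2
  rw [h1, h2, e, mul_assoc]

theorem MulRel.const_smul {m : R3 → ℂ} {f g : L2} (h : MulRel m f g) (c : ℂ) :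
    MulRel (fun ξ => c * m ξ) f (c • g) := by
  unfold MulRel
  rw [FourierSMul.fourier_smul]
  filter_upwards [h, Lp.coeFn_smul c (𝓕 g : L2)] with ξ h1 h2
  rw [h2, Pi.smul_apply, h1, smul_eq_mul, mul_assoc]

theorem eLpNorm_smul_L2 {c : ℝ} (hc : 0 ≤ c) (g : L2) (r : ℝ≥0∞) :
    eLpNorm ((c : ℂ) • g : L2) r volume = ENNReal.ofReal c * eLpNorm g r volume := by
  rw [eLpNorm_congr_ae (Lp.coeFn_smul _ _), eLpNorm_const_smul]
  congr 1
  rw [← ofReal_norm, Complex.norm_real, Real.norm_of_nonneg hc]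

/-! ### Dyadic cutoffs and uniform L^r multiplier bounds -/

/-- A smooth bump equal to `1` on the ball of radius `1/2` and supported in the unit ball. -/
def cutoffBump : ContDiffBump (0 : R3) := ⟨1 / 2, 1, by norm_num, by norm_num⟩

/-- The low frequency cutoff. -/
def cutoff (ξ : R3) : ℝ := cutoffBump ξ

theorem contDiff_cutoff : ContDiff ℝ ∞ cutoff := cutoffBump.contDiff

theorem hasCompactSupport_cutoff : HasCompactSupport cutoff := cutoffBump.hasCompactSupport

theorem cutoff_nonneg (ξ : R3) : 0 ≤ cutoff ξ := cutoffBump.nonneg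

theorem cutoff_le_one (ξ : R3) : cutoff ξ ≤ 1 := cutoffBump.le_one

theorem cutoff_eq_one {ξ : R3} (h : ‖ξ‖ ≤ 1 / 2) : cutoff ξ = 1 :=
  cutoffBump.one_of_mem_closedBall (by simpa [cutoffBump] using h)

theorem cutoff_eq_zero {ξ : R3} (h : 1 ≤ ‖ξ‖) : cutoff ξ = 0 :=
  cutoffBump.zero_of_le_dist (by simpa [cutoffBump] using h)

/-- A smooth function supported in the annulus `1/4 ≤ |ξ| ≤ 1`. -/
def annulus (ξ : R3) : ℝ := cutoff ξ - cutoff ((2 : ℝ) • ξ)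

theorem annulus_eq_zero_of_le {ξ : R3} (h : ‖ξ‖ ≤ 1 / 4) : annulus ξ = 0 := by
  have h2 : ‖(2 : ℝ) • ξ‖ ≤ 1 / 2 := by rw [norm_smul, Real.norm_ofNat]; linarith
  rw [annulus, cutoff_eq_one (by linarith), cutoff_eq_one h2, sub_self]

theorem annulus_eq_zero_of_ge {ξ : R3} (h : 1 ≤ ‖ξ‖) : annulus ξ = 0 := by
  have h2 : 1 ≤ ‖(2 : ℝ) • ξ‖ := by rw [norm_smul, Real.norm_ofNat]; linarith
  rw [annulus, cutoff_eq_zero h, cutoff_eq_zero h2, sub_self]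

theorem contDiff_annulus : ContDiff ℝ ∞ annulus :=
  contDiff_cutoff.sub (contDiff_cutoff.comp (contDiff_const_smul _))

theorem contDiffAt_norm_rpow {ξ : R3} (h : ξ ≠ 0) (a : ℝ) :
    ContDiffAt ℝ ∞ (fun ξ : R3 => ‖ξ‖ ^ a) ξ :=
  (contDiffAt_norm ℝ h).rpow_const_of_ne (norm_ne_zero_iff.2 h)

/-- The annulus cutoff times a power of `|ξ|`. -/
def annulusPow (a : ℝ) (ξ : R3) : ℝ := annulus ξ * ‖ξ‖ ^ a

theorem contDiff_annulusPow (a : ℝ) : ContDiff ℝ ∞ (annulusPow a) := by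
  rw [contDiff_iff_contDiffAt]
  intro ξ
  rcases eq_or_ne ξ 0 with rfl | h
  · refine (contDiffAt_const (c := (0 : ℝ))).congr_of_eventuallyEq ?_
    filter_upwards [Metric.closedBall_mem_nhds (0 : R3) (show (0 : ℝ) < 1 / 4 by norm_num)]
      with ζ hζ
    rw [annulusPow, annulus_eq_zero_of_le (by simpa using hζ), zero_mul]
  · exact contDiff_annulus.contDiffAt.mul (contDiffAt_norm_rpow h a)

theorem hasCompactSupport_annulusPow (a : ℝ) : HasCompactSupport (annulusPow a) := by
  refine HasCompactSupport.intro (isCompact_closedBall (0 : R3) 1) fun ξ hξ => ?_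
  rw [annulusPow, annulus_eq_zero_of_ge, zero_mul]
  simp at hξ; exact hξ.le

theorem sum_annulus (n : ℕ) (ξ : R3) :
    ∑ j ∈ Finset.range n, annulus ((2 : ℝ) ^ j • ξ) = cutoff ξ - cutoff ((2 : ℝ) ^ n • ξ) := by
  have : ∀ j, annulus ((2 : ℝ) ^ j • ξ) =
      cutoff ((2 : ℝ) ^ j • ξ) - cutoff ((2 : ℝ) ^ (j + 1) • ξ) := fun j => by
    rw [annulus, smul_smul, pow_succ']
  simp_rw [this]
  rw [Finset.sum_range_sub']; simp

theorem exists_abs_le_of_rpow {ρ : R3 → ℝ} (hρ : Continuous ρ) {δ : ℝ} (hδ : 0 ≤ δ)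
    (h : ∀ ξ, 2 ≤ ‖ξ‖ → ρ ξ = ‖ξ‖ ^ (-δ)) : ∃ c, ∀ ξ, |ρ ξ| ≤ c := by
  obtain ⟨c, hc⟩ := (isCompact_closedBall (0 : R3) 2).exists_bound_of_continuousOn hρ.continuousOn
  refine ⟨max c 1, fun ξ => ?_⟩
  rcases le_total ‖ξ‖ 2 with h2 | h2
  · exact (hc ξ (by simpa using h2)).trans (le_max_left _ _)
  · refine le_trans ?_ (le_max_right _ _)
    rw [h ξ h2, abs_of_nonneg (by positivity)]
    exact Real.rpow_le_one_of_one_le_of_nonpos (by linarith) (by linarith)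

theorem tsum_geometric_bound (C : ℝ≥0) (E : ℝ≥0∞) {x : ℝ} (hx : x < 1) :
    ∑' j : ℕ, C * ENNReal.ofReal x ^ j * E =
      ((C * ((1 - ENNReal.ofReal x)⁻¹).toNNReal : ℝ≥0) : ℝ≥0∞) * E := by
  have h1 : ENNReal.ofReal x < 1 := by simpa using ENNReal.ofReal_lt_one.2 hx
  have : (1 - ENNReal.ofReal x)⁻¹ ≠ ⊤ := by
    rw [Ne, ENNReal.inv_eq_top]; exact (tsub_pos_of_lt h1).ne'
  rw [ENNReal.tsum_mul_right, ENNReal.tsum_mul_left, ENNReal.tsum_geometric, ENNReal.coe_mul,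
    ENNReal.coe_toNNReal this]

/-- A smooth symbol equal to a negative power of `|ξ|` for large `|ξ|` is bounded on `L^r`,
uniformly in the frequency scale. -/
theorem exists_Lr_bound {ρ : R3 → ℝ} (hρ : ContDiff ℝ ∞ ρ) {δ : ℝ} (hδ : 0 < δ)
    (h : ∀ ξ, 2 ≤ ‖ξ‖ → ρ ξ = ‖ξ‖ ^ (-δ)) {r : ℝ} (hr : 1 < r) :
    ∃ C : ℝ≥0, ∀ N : ℝ, 0 < N → ∀ f g : L2, MulRel (sym fun ξ => ρ (N⁻¹ • ξ)) f g →
      eLpNorm g (ENNReal.ofReal r) volume ≤ C * eLpNorm f (ENNReal.ofReal r) volume := by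
  -- The scale 8 makes the cutoff equal to 1 on |ξ| ≤ 4, so the remaining dyadic pieces live where
  -- `ρ` is the pure power. The piece at scale 2^{j+4} is then x^{j+4} times a dilate of one fixed
  -- annular symbol, whose L^r bound is independent of scale, and the series is geometric.
  let ρ₀ : R3 → ℝ := fun ξ => ρ ξ * cutoff ((8 : ℝ)⁻¹ • ξ)
  have hρ₀ : ContDiff ℝ ∞ ρ₀ := hρ.mul (contDiff_cutoff.comp (contDiff_const_smul _))
  have hρ₀c : HasCompactSupport ρ₀ :=
    (hasCompactSupport_cutoff.comp_smul (by norm_num)).mul_left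
  obtain ⟨C₀, hC₀⟩ := exists_bernstein hρ₀ hρ₀c hr
  obtain ⟨C₁, hC₁⟩ := exists_bernstein (contDiff_annulusPow (-δ))
    (hasCompactSupport_annulusPow (-δ)) hr
  obtain ⟨c, hc⟩ := exists_abs_le_of_rpow hρ.continuous hδ.le h
  have hx0 : (0 : ℝ) < 2 ^ (-δ) := by positivity
  have hx : (2 : ℝ) ^ (-δ) < 1 := Real.rpow_lt_one_of_one_lt_of_neg one_lt_two (by linarith)
  set x : ℝ := 2 ^ (-δ) with hxdef
  refine ⟨(C₀ + C₁) * ((1 - ENNReal.ofReal x)⁻¹).toNNReal, fun N hN f g hg => ?_⟩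
  rw [← tsum_geometric_bound _ _ hx]
  have hbd : ∀ (θ : R3 → ℝ), Continuous θ → HasCompactSupport θ → ∀ c' : ℝ,
      ∃ u, MulRel (sym fun ξ => θ (c' • ξ)) f u := by
    intro θ hθ hθc c'
    obtain ⟨B, hB⟩ := hθc.exists_bound_of_continuous hθ
    exact exists_mulRel (hθ.comp (continuous_const_smul c')).measurable (fun ξ => hB _) f
  obtain ⟨u₀, hu₀⟩ := hbd ρ₀ hρ₀.continuous hρ₀c N⁻¹
  choose v hv using fun j : ℕ => hbd (annulusPow (-δ)) (contDiff_annulusPow _).continuous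
    (hasCompactSupport_annulusPow _) (2 ^ (j + 4) * N)⁻¹
  -- Truncations of `ρ` whose increments telescope; the offset 3 matches the initial cutoff at scale
  -- 8 = 2³.
  let S : ℕ → R3 → ℝ := fun n ξ => ρ ξ * cutoff (((2 : ℝ) ^ (n + 3))⁻¹ • ξ)
  let m : ℕ → R3 → ℂ := fun n => match n with
    | 0 => sym fun ξ => ρ₀ (N⁻¹ • ξ)
    | (j + 1) => sym fun ξ => S (j + 1) (N⁻¹ • ξ) - S j (N⁻¹ • ξ)
  let u : ℕ → L2 := fun n => match n with
    | 0 => u₀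
    | (j + 1) => ((x ^ (j + 4) : ℝ) : ℂ) • v j
  have hu : ∀ n, MulRel (m n) f (u n) := by
    intro n
    cases n with
    | zero => exact hu₀
    | succ j =>
      refine ((hv j).const_smul ((x ^ (j + 4) : ℝ) : ℂ)).congr (Filter.Eventually.of_forall ?_)
      intro ξ
      simp only [m, sym, ← Complex.ofReal_mul]
      congr 1
      generalize (2 * Real.pi) • ξ = ξ
      have e1 : (2 ^ (j + 4) * N)⁻¹ • ξ = ((2 : ℝ) ^ (j + 4))⁻¹ • (N⁻¹ • ξ) := by
        rw [mul_inv, smul_smul]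
      rw [e1]
      generalize N⁻¹ • ξ = ζ
      simp only [S, annulusPow, annulus]
      have e2 : (2 : ℝ) • (((2 : ℝ) ^ (j + 4))⁻¹ • ζ) = ((2 : ℝ) ^ (j + 3))⁻¹ • ζ := by
        rw [smul_smul]; congr 1; rw [pow_succ]; field_simp
      rw [e2]
      rcases le_total 2 ‖ζ‖ with h2 | h2
      · have e3 : x ^ (j + 4) * ‖((2 : ℝ) ^ (j + 4))⁻¹ • ζ‖ ^ (-δ) = ρ ζ := by
          rw [h ζ h2, norm_smul, Real.norm_of_nonneg (by positivity),
            Real.mul_rpow (by positivity) (by positivity), hxdef, ← Real.rpow_natCast,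
            ← Real.rpow_mul zero_le_two, ← mul_assoc, ← Real.rpow_natCast 2 (j + 4),
            Real.inv_rpow (by positivity), ← Real.rpow_mul zero_le_two, mul_comm (-δ),
            mul_inv_cancel₀ (by positivity), one_mul]
        rw [← e3]; ring_nf
      · have e4 : ∀ i : ℕ, 3 ≤ i → cutoff (((2 : ℝ) ^ i)⁻¹ • ζ) = 1 := by
          intro i hi
          refine cutoff_eq_one ?_
          have : (8 : ℝ) ≤ 2 ^ i := by
            calc (8 : ℝ) = 2 ^ 3 := by norm_num
              _ ≤ 2 ^ i := pow_le_pow_right₀ one_le_two hi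
          rw [norm_smul, Real.norm_of_nonneg (by positivity), inv_mul_le_iff₀ (by positivity)]
          linarith
        rw [e4 _ (by omega), e4 _ (by omega)]
        simp
  have hsum : ∀ n ξ, ∑ j ∈ Finset.range (n + 1), m j ξ = sym (fun ξ => S n (N⁻¹ • ξ)) ξ := by
    intro n ξ
    induction n with
    | zero => simp [m, S, ρ₀, sym]; norm_num
    | succ n ih =>
      rw [Finset.sum_range_succ, ih]
      simp [m, sym]
  refine eLpNorm_le_tsum hu hg (c := c) ?_ ?_ ?_ ?_
  · intro n ξ
    cases n with
    | zero => simpa [sym] using hc _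
    | succ n =>
      rw [hsum]
      simp only [sym, ← Complex.ofReal_sub, Complex.norm_real, S, Real.norm_eq_abs]
      generalize N⁻¹ • (2 * Real.pi) • ξ = ζ
      rw [show ρ ζ * cutoff (((2 : ℝ) ^ (n + 3))⁻¹ • ζ) - ρ ζ =
        ρ ζ * (cutoff (((2 : ℝ) ^ (n + 3))⁻¹ • ζ) - 1) by ring, abs_mul]
      have h1 : |cutoff (((2 : ℝ) ^ (n + 3))⁻¹ • ζ) - 1| ≤ 1 := by
        rw [abs_le]
        constructor <;> linarith [cutoff_nonneg (((2 : ℝ) ^ (n + 3))⁻¹ • ζ),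
          cutoff_le_one (((2 : ℝ) ^ (n + 3))⁻¹ • ζ)]
      calc _ ≤ |ρ ζ| * 1 := by gcongr
        _ ≤ c := by rw [mul_one]; exact hc ζ
  · refine Filter.Eventually.of_forall fun ξ => ?_
    rw [← Filter.tendsto_add_atTop_iff_nat 1]
    simp_rw [hsum]
    simp only [sym, S]
    refine (Complex.continuous_ofReal.tendsto _).comp ?_
    generalize N⁻¹ • (2 * Real.pi) • ξ = ζ
    have h1 : Filter.Tendsto (fun n : ℕ => ((2 : ℝ) ^ (n + 3))⁻¹ • ζ) Filter.atTop (nhds 0) := by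
      have : Filter.Tendsto (fun n : ℕ => ((2 : ℝ) ^ (n + 3))⁻¹) Filter.atTop (nhds 0) :=
        (tendsto_inv_atTop_zero.comp (tendsto_pow_atTop_atTop_of_one_lt one_lt_two)).comp
          (Filter.tendsto_add_atTop_nat 3)
      simpa using this.smul_const ζ
    have h2 := ((contDiff_cutoff.continuous.tendsto 0).comp h1).const_mul (ρ ζ)
    rw [cutoff_eq_one (by simp), mul_one] at h2
    exact h2
  · exact ENNReal.one_le_ofReal.2 hr.le
  · intro n
    cases n with
    | zero =>
      refine ((hC₀ N hN f u₀ hu₀).1).trans ?_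
      simp only [pow_zero, mul_one]
      gcongr
      exact le_self_add
    | succ j =>
      simp only [u]
      rw [eLpNorm_smul_L2 (by positivity)]
      have h1 := (hC₁ (2 ^ (j + 4) * N) (by positivity) f (v j) (hv j)).1
      have h2 : ENNReal.ofReal (x ^ (j + 4)) ≤ ENNReal.ofReal x ^ (j + 1) := by
        rw [← ENNReal.ofReal_pow hx0.le]
        exact ENNReal.ofReal_le_ofReal (pow_le_pow_of_le_one hx0.le hx.le (by omega))
      have h3 : (C₁ : ℝ≥0∞) ≤ ((C₀ + C₁ : ℝ≥0) : ℝ≥0∞) := ENNReal.coe_le_coe.2 le_add_self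
      calc _ ≤ ENNReal.ofReal x ^ (j + 1) *
            (((C₀ + C₁ : ℝ≥0) : ℝ≥0∞) * eLpNorm f (ENNReal.ofReal r) volume) := by
            gcongr; exact h1.trans (by gcongr)
        _ = _ := by ring

/-! ### Low and high frequencies in terms of D^b I f -/

namespace IsProfile

variable {s : ℝ} {η : R3 → ℝ}

theorem pos (hη : IsProfile s η) (ξ : R3) : 0 < η ξ := by
  obtain ⟨v, hv⟩ := exists_norm_eq R3 (show (0 : ℝ) ≤ max 2 ‖ξ‖ by positivity)
  refine lt_of_lt_of_le ?_ (hη.radial_antitone ξ v (by rw [hv]; exact le_max_right _ _))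
  have h2 : 2 ≤ ‖v‖ := by rw [hv]; exact le_max_left _ _
  rw [hη.eq_rpow v h2]
  have : 0 < ‖v‖ := by linarith
  positivity

theorem le_one (hη : IsProfile s η) (ξ : R3) : η ξ ≤ 1 := by
  rw [← hη.eq_one 0 (by simp)]
  exact hη.radial_antitone 0 ξ (by simp)

theorem eq_rpow' (hη : IsProfile s η) {ξ : R3} (h : 2 ≤ ‖ξ‖) : η ξ = ‖ξ‖ ^ (-(1 - s)) := by
  rw [hη.eq_rpow ξ h, Real.rpow_neg (norm_nonneg _), one_div]

end IsProfile

theorem cutoff_mul_profile {s : ℝ} {η : R3 → ℝ} (hη : IsProfile s η) (ξ : R3) :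
    cutoff ξ * η ξ = cutoff ξ := by
  rcases le_total ‖ξ‖ 1 with h | h
  · rw [hη.eq_one ξ h, mul_one]
  · rw [cutoff_eq_zero h, zero_mul]

theorem annulus_mul_profile_smul {s : ℝ} {η : R3 → ℝ} (hη : IsProfile s η) (j : ℕ) (ξ : R3) :
    annulus ((2 : ℝ) ^ j • ξ) * η ξ = annulus ((2 : ℝ) ^ j • ξ) := by
  rcases le_total ‖ξ‖ 1 with h | h
  · rw [hη.eq_one ξ h, mul_one]
  · rw [annulus_eq_zero_of_ge, zero_mul]
    rw [norm_smul, Real.norm_of_nonneg (by positivity)]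
    exact one_le_mul_of_one_le_of_one_le (one_le_pow₀ one_le_two) h

/-- The low frequencies of `f` are bounded by `D^b I f` in `L^r`. -/
theorem exists_low_sup_bound {s : ℝ} {η : R3 → ℝ} (hη : IsProfile s η) {b r : ℝ} (hr : 1 < r)
    (hb : b < 3 / r) :
    ∃ C : ℝ≥0, ∀ N : ℝ, 0 < N → ∀ f F g : L2, MulRel (sym (symbolDI b η N)) f F →
      MulRel (sym fun ξ => cutoff (N⁻¹ • ξ)) f g →
      eLpNorm g ⊤ volume ≤
        C * ENNReal.ofReal (N ^ (3 / r - b)) * eLpNorm F (ENNReal.ofReal r) volume := by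
  obtain ⟨C₁, hC₁⟩ := exists_bernstein (contDiff_annulusPow (-b))
    (hasCompactSupport_annulusPow (-b)) hr
  -- The annulus at scale M = 2^{-j}N costs M^{3/r} by Bernstein and gains M^{-b} from inverting
  -- |ξ|^b, so the pieces decay like 2^{-j(3/r-b)}. This is where b < 3/r is needed.
  have hx : (2 : ℝ) ^ (-(3 / r - b)) < 1 :=
    Real.rpow_lt_one_of_one_lt_of_neg one_lt_two (by linarith)
  set x : ℝ := 2 ^ (-(3 / r - b)) with hxdef
  have hx0 : 0 < x := by positivity
  refine ⟨C₁ * ((1 - ENNReal.ofReal x)⁻¹).toNNReal, fun N hN f F g hF hg => ?_⟩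
  rw [mul_assoc, ← tsum_geometric_bound _ _ hx]
  have hbd : ∀ j : ℕ, ∃ v, MulRel (sym fun ξ => annulusPow (-b) (((2 ^ j)⁻¹ * N)⁻¹ • ξ)) F v := by
    intro j
    obtain ⟨B, hB⟩ := (hasCompactSupport_annulusPow (-b)).exists_bound_of_continuous
      (contDiff_annulusPow (-b)).continuous
    exact exists_mulRel ((contDiff_annulusPow (-b)).continuous.comp
      (continuous_const_smul _)).measurable (fun ξ => hB _) F
  choose v hv using hbd
  let m : ℕ → R3 → ℂ := fun j => sym fun ξ => annulus ((2 : ℝ) ^ j • (N⁻¹ • ξ))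
  have hu : ∀ j, MulRel (m j) f (((((2 ^ j)⁻¹ * N) ^ (-b) : ℝ) : ℂ) • v j) := by
    intro j
    have hM : 0 < (2 ^ j)⁻¹ * N := by positivity
    have := (hF.comp (hv j)).const_smul ((((2 ^ j)⁻¹ * N) ^ (-b) : ℝ) : ℂ)
    refine this.congr (Filter.Eventually.of_forall fun ξ => ?_)
    simp only [m, sym, ← Complex.ofReal_mul]
    congr 1
    generalize (2 * Real.pi) • ξ = ξ
    have e1 : ((2 ^ j)⁻¹ * N)⁻¹ • ξ = (2 : ℝ) ^ j • (N⁻¹ • ξ) := by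
      rw [mul_inv, inv_inv, smul_smul]
    have e2 : ‖((2 ^ j)⁻¹ * N)⁻¹ • ξ‖ = ((2 ^ j)⁻¹ * N)⁻¹ * ‖ξ‖ := by
      rw [norm_smul, Real.norm_of_nonneg (by positivity)]
    have e3 := annulus_mul_profile_smul hη j (N⁻¹ • ξ)
    rw [annulusPow, symbolDI, symbolI, e2, e1]
    rcases eq_or_ne ξ 0 with rfl | h0
    · simp [annulus_eq_zero_of_le]
    · generalize annulus ((2 : ℝ) ^ j • (N⁻¹ • ξ)) = A at e3 ⊢
      clear this e1 e2
      generalize (2 ^ j)⁻¹ * N = M at hM ⊢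
      rw [Real.mul_rpow (by positivity) (by positivity), Real.inv_rpow hM.le,
        Real.rpow_neg hM.le, inv_inv, Real.rpow_neg (norm_nonneg _)]
      have h1 : M ^ b ≠ 0 := (Real.rpow_pos_of_pos hM _).ne'
      have h2 : ‖ξ‖ ^ b ≠ 0 := (Real.rpow_pos_of_pos (norm_pos_iff.2 h0) _).ne'
      nth_rewrite 2 [← e3]
      field_simp
  have hsum : ∀ n ξ, ∑ j ∈ Finset.range n, m j ξ =
      sym (fun ξ => cutoff (N⁻¹ • ξ) - cutoff ((2 : ℝ) ^ n • (N⁻¹ • ξ))) ξ := by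
    intro n ξ
    simp only [m, sym, ← Complex.ofReal_sum, sum_annulus]
  refine eLpNorm_le_tsum hu hg (c := 1) ?_ ?_ le_top ?_
  · intro n ξ
    rw [hsum]
    simp only [sym, ← Complex.ofReal_sub, Complex.norm_real, Real.norm_eq_abs]
    rw [sub_sub_cancel_left, abs_neg, abs_of_nonneg (cutoff_nonneg _)]
    exact cutoff_le_one _
  -- The telescoping sum over annuli misses only the zero frequency, a null set.
  · have h0 : ∀ᵐ ξ : R3, ξ ≠ 0 := by
      simp [ae_iff]
    filter_upwards [h0] with ξ hξ
    simp_rw [hsum]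
    refine tendsto_const_nhds.congr' ?_
    have hpos : 0 < ‖N⁻¹ • (2 * Real.pi) • ξ‖ := by
      rw [norm_pos_iff]
      exact smul_ne_zero (by positivity) (smul_ne_zero (by positivity) hξ)
    have := (tendsto_pow_atTop_atTop_of_one_lt (one_lt_two (α := ℝ))).eventually_ge_atTop
      (‖N⁻¹ • (2 * Real.pi) • ξ‖⁻¹)
    filter_upwards [this] with n hn
    simp only [sym]
    rw [cutoff_eq_zero (ξ := (2 : ℝ) ^ n • N⁻¹ • (2 * Real.pi) • ξ), sub_zero]
    rw [norm_smul, Real.norm_of_nonneg (by positivity)]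
    rwa [inv_le_iff_one_le_mul₀ hpos] at hn
  · intro j
    have hM : 0 < (2 ^ j)⁻¹ * N := by positivity
    rw [eLpNorm_smul_L2 (by positivity)]
    refine (mul_le_mul_right (hC₁ _ hM F (v j) (hv j)).2 _).trans (le_of_eq ?_)
    have : ENNReal.ofReal (((2 ^ j)⁻¹ * N) ^ (-b)) * ENNReal.ofReal (((2 ^ j)⁻¹ * N) ^ (3 / r)) =
        ENNReal.ofReal x ^ j * ENNReal.ofReal (N ^ (3 / r - b)) := by
      rw [← ENNReal.ofReal_pow hx0.le, ← ENNReal.ofReal_mul (by positivity),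
        ← ENNReal.ofReal_mul (by positivity), ← Real.rpow_add hM,
        Real.mul_rpow (by positivity) hN.le, Real.inv_rpow (by positivity), hxdef,
        ← Real.rpow_natCast, ← Real.rpow_natCast, ← Real.rpow_mul zero_le_two,
        ← Real.rpow_mul zero_le_two, ← Real.rpow_neg zero_le_two]
      ring_nf
    calc _ = (C₁ : ℝ≥0∞) * (ENNReal.ofReal (((2 ^ j)⁻¹ * N) ^ (-b)) *
          ENNReal.ofReal (((2 ^ j)⁻¹ * N) ^ (3 / r))) *
            eLpNorm F (ENNReal.ofReal r) volume := by ring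
      _ = _ := by rw [this]; ring

/-- The high frequencies of `f` are bounded by `D^b I f` in `L^r`. -/
theorem exists_high_bound {s : ℝ} {η : R3 → ℝ} (hη : IsProfile s η) {b r : ℝ} (hr : 1 < r)
    (hb : 1 - s < b) :
    ∃ C : ℝ≥0, ∀ N : ℝ, 0 < N → ∀ f F g : L2, MulRel (sym (symbolDI b η N)) f F →
      MulRel (sym fun ξ => 1 - cutoff (N⁻¹ • ξ)) f g →
      eLpNorm g (ENNReal.ofReal r) volume ≤
        C * ENNReal.ofReal (N ^ (-b)) * eLpNorm F (ENNReal.ofReal r) volume := by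
  -- The symbol taking D^b I f to N^b g, in the variable ξ/N. It vanishes near the origin, so
  -- |ξ|^{-b} causes no singularity, and for |ξ| ≥ 2 the factor 1/η = |ξ|^{1-s} leaves the decaying
  -- power |ξ|^{-(b-(1-s))}.
  let ρ : R3 → ℝ := fun ξ => (1 - cutoff ξ) * (‖ξ‖ ^ (-b) * (η ξ)⁻¹)
  have hρ : ContDiff ℝ ∞ ρ := by
    rw [contDiff_iff_contDiffAt]
    intro ξ
    rcases eq_or_ne ξ 0 with rfl | h
    · refine (contDiffAt_const (c := (0 : ℝ))).congr_of_eventuallyEq ?_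
      filter_upwards [Metric.closedBall_mem_nhds (0 : R3) (show (0 : ℝ) < 1 / 2 by norm_num)]
        with ζ hζ
      simp only [ρ]
      rw [cutoff_eq_one (by simpa using hζ), sub_self, zero_mul]
    · exact (contDiffAt_const.sub contDiff_cutoff.contDiffAt).mul
        ((contDiffAt_norm_rpow h _).mul (hη.smooth.contDiffAt.inv (hη.pos ξ).ne'))
  obtain ⟨C, hC⟩ := exists_Lr_bound hρ (δ := b - (1 - s)) (by linarith) (fun ξ hξ => by
    have h0 : 0 < ‖ξ‖ := by linarith
    simp only [ρ]
    rw [cutoff_eq_zero (by linarith), hη.eq_rpow' hξ, sub_zero, one_mul,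
      ← Real.rpow_neg h0.le, ← Real.rpow_add h0]
    congr 1; ring) hr
  refine ⟨C, fun N hN f F g hF hg => ?_⟩
  have h1 : MulRel (sym fun ξ => ρ (N⁻¹ • ξ)) F (((N ^ b : ℝ) : ℂ) • g) := by
    refine hF.of_factor (hg.const_smul _) fun ξ => ?_
    simp only [sym, ← Complex.ofReal_mul]
    congr 1
    generalize (2 * Real.pi) • ξ = ξ
    simp only [ρ, symbolDI, symbolI]
    rcases eq_or_ne ξ 0 with rfl | h0
    · simp [cutoff_eq_one]
    · have h2 : ‖ξ‖ ^ b ≠ 0 := (Real.rpow_pos_of_pos (norm_pos_iff.2 h0) _).ne'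
      have h3 : N ^ b ≠ 0 := (Real.rpow_pos_of_pos hN _).ne'
      rw [norm_smul, Real.norm_of_nonneg (by positivity), Real.mul_rpow (by positivity)
        (by positivity), Real.inv_rpow hN.le, Real.rpow_neg hN.le, inv_inv,
        Real.rpow_neg (norm_nonneg _)]
      have h4 := (hη.pos (N⁻¹ • ξ)).ne'
      generalize N⁻¹ • ξ = ζ at h4 ⊢
      field_simp
  have h2 := hC N hN F _ h1
  rw [eLpNorm_smul_L2 (by positivity)] at h2
  have h3 : ENNReal.ofReal (N ^ (-b)) * ENNReal.ofReal (N ^ b) = 1 := by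
    rw [← ENNReal.ofReal_mul (by positivity), ← Real.rpow_add hN]; simp
  calc eLpNorm g (ENNReal.ofReal r) volume
      = ENNReal.ofReal (N ^ (-b)) * (ENNReal.ofReal (N ^ b) *
          eLpNorm g (ENNReal.ofReal r) volume) := by rw [← mul_assoc, h3, one_mul]
    _ ≤ ENNReal.ofReal (N ^ (-b)) * (C * eLpNorm F (ENNReal.ofReal r) volume) := by gcongr
    _ = _ := by ring

/-! ### Translations and the L² gradient on the Fourier side -/

theorem eLpNorm_two_sq (u : R3 → ℂ) : eLpNorm u 2 volume ^ 2 = ∫⁻ x, ‖u x‖ₑ ^ 2 := by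
  rw [eLpNorm_eq_lintegral_rpow_enorm_toReal two_ne_zero ENNReal.ofNat_ne_top,
    ← ENNReal.rpow_natCast, ← ENNReal.rpow_mul]
  norm_num

/-- Translation by `v` on `L²`. -/
def translate (v : R3) (f : L2) : L2 :=
  Lp.compMeasurePreserving (fun x => x - v) (measurePreserving_sub_right volume v) f

theorem coeFn_translate (v : R3) (f : L2) : translate v f =ᵐ[volume] fun x => f (x - v) :=
  Lp.coeFn_compMeasurePreserving f _

/-- The symbol of the translation by `v`. -/
def waveSymbol (v ξ : R3) : ℂ := Complex.exp (-(2 * Real.pi * inner ℝ v ξ : ℝ) * Complex.I)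

theorem norm_waveSymbol (v ξ : R3) : ‖waveSymbol v ξ‖ = 1 := by
  rw [waveSymbol, ← Complex.ofReal_neg]; exact Complex.norm_exp_ofReal_mul_I _

theorem continuous_waveSymbol (v : R3) : Continuous (waveSymbol v) := by
  unfold waveSymbol; fun_prop

theorem fourier_comp_sub (φ : 𝓢(R3, ℂ)) (v ξ : R3) :
    𝓕 (φ.compSubConstCLM ℂ v) ξ = waveSymbol v ξ * 𝓕 φ ξ := by
  rw [SchwartzMap.fourier_coe, SchwartzMap.fourier_coe, Real.fourier_eq', Real.fourier_eq',
    ← integral_const_mul]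
  rw [← integral_add_right_eq_self _ v]
  refine integral_congr_ae (Filter.Eventually.of_forall fun x => ?_)
  simp only [SchwartzMap.compSubConstCLM_apply, waveSymbol, add_sub_cancel_right, smul_eq_mul]
  rw [← mul_assoc, ← Complex.exp_add, inner_add_left]
  congr 2
  push_cast
  ring

theorem mulRel_translate (v : R3) (f : L2) : MulRel (waveSymbol v) f (translate v f) := by
  have hm : MemLp (waveSymbol v) ⊤ (volume : Measure R3) :=
    memLp_top_of_bound (continuous_waveSymbol v).aestronglyMeasurable 1
      (Filter.Eventually.of_forall fun ξ => (norm_waveSymbol v ξ).le)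
  suffices H : translate v f = mulCLM (hm.toLp _) f by rw [H]; exact mulRel_mulCLM hm f
  refine DenseRange.induction_on (p := fun f => translate v f = mulCLM (hm.toLp _) f)
    (SchwartzMap.denseRange_toLpCLM (E := R3) (F := ℂ) (p := 2) (μ := volume)
      ENNReal.ofNat_ne_top) f ?_ ?_
  · exact isClosed_eq (Lp.isometry_compMeasurePreserving _).continuous (mulCLM _).continuous
  · intro φ
    have h1 : translate v (φ.toLp 2) = (φ.compSubConstCLM ℂ v).toLp 2 := by
      refine Lp.ext ?_
      filter_upwards [coeFn_translate v (φ.toLp 2), (φ.compSubConstCLM ℂ v).coeFn_toLp 2 volume,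
        (measurePreserving_sub_right volume v).quasiMeasurePreserving.ae
          (φ.coeFn_toLp 2 volume)] with x h1 h2 h3
      rw [h1, h2, h3, SchwartzMap.compSubConstCLM_apply]
    have h2 : MulRel (waveSymbol v) (φ.toLp 2) ((φ.compSubConstCLM ℂ v).toLp 2) := by
      unfold MulRel
      rw [SchwartzMap.toLp_fourier_eq, SchwartzMap.toLp_fourier_eq]
      filter_upwards [(𝓕 (φ.compSubConstCLM ℂ v)).coeFn_toLp 2 volume,
        (𝓕 φ).coeFn_toLp 2 volume] with ξ h1 h2
      rw [h1, h2, fourier_comp_sub]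
    change translate v (φ.toLp 2) = mulCLM (hm.toLp _) (φ.toLp 2)
    rw [h1]
    exact h2.unique (mulRel_mulCLM hm _)

theorem norm_waveSymbol_sub_one_le (v ξ : R3) :
    ‖waveSymbol v ξ - 1‖ ≤ 2 * Real.pi * (‖v‖ * ‖ξ‖) := by
  have h := Real.norm_exp_I_mul_ofReal_sub_one_le (x := -(2 * Real.pi * inner ℝ v ξ))
  have e : waveSymbol v ξ = Complex.exp (Complex.I * (-(2 * Real.pi * inner ℝ v ξ) : ℝ)) := by
    rw [waveSymbol, mul_comm]; push_cast; ring_nf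
  rw [e]
  refine h.trans ?_
  rw [norm_neg, norm_mul, norm_mul, Real.norm_of_nonneg Real.pi_pos.le, Real.norm_ofNat]
  gcongr
  exact norm_inner_le_norm v ξ

theorem tendsto_waveSymbol_slope (v ξ : R3) :
    Filter.Tendsto (fun n : ℕ => ‖((n : ℝ) + 1) • (waveSymbol (((n : ℝ) + 1)⁻¹ • v) ξ - 1)‖ₑ)
      Filter.atTop (nhds ‖2 * Real.pi * inner ℝ v ξ‖ₑ) := by
  set a : ℝ := 2 * Real.pi * inner ℝ v ξ
  have hd : HasDerivAt (fun t : ℝ => Complex.exp (-(t * a : ℝ) * Complex.I)) (-a * Complex.I) 0 := by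
    have h1 : HasDerivAt (fun t : ℝ => ((-(t * a : ℝ) : ℂ) * Complex.I)) (-a * Complex.I) 0 := by
      have := ((hasDerivAt_id (0 : ℝ)).mul_const a).ofReal_comp.neg.mul_const Complex.I
      simpa using this
    simpa using h1.cexp
  have hs := hd.tendsto_slope_zero
  have ht : Filter.Tendsto (fun n : ℕ => ((n : ℝ) + 1)⁻¹) Filter.atTop (nhdsWithin 0 {0}ᶜ) := by
    refine tendsto_nhdsWithin_iff.2 ⟨?_, Filter.Eventually.of_forall fun n => ?_⟩
    · simpa [one_div] using tendsto_one_div_add_atTop_nhds_zero_nat (𝕜 := ℝ)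
    · have : ((n : ℝ) + 1)⁻¹ ≠ 0 := by positivity
      exact this
  have h := (continuous_enorm.tendsto _).comp (hs.comp ht)
  have e : ‖(-a * Complex.I : ℂ)‖ₑ = ‖a‖ₑ := by
    rw [enorm_eq_iff_norm_eq]; simp
  rw [e] at h
  refine h.congr fun n => ?_
  simp only [Function.comp_apply, zero_add, zero_mul, Complex.ofReal_zero, neg_zero,
    Complex.exp_zero, inv_inv, waveSymbol, inner_smul_left]
  simp [a, mul_left_comm]

/-- If `G` is locally Lipschitz-dominated by `f`, then `‖∇G‖ ≤ √3 K ‖∇f‖` on the Fourier side. -/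
theorem lintegral_fourier_gradient_le {f G : L2} {K : ℝ}
    (h : ∀ v : R3, ∀ᵐ x, ‖G (x - v) - G x‖ ≤ K * ‖f (x - v) - f x‖) :
    ∫⁻ ξ, (‖ξ‖ₑ * ‖(𝓕 G : L2) ξ‖ₑ) ^ 2 ≤
      3 * (ENNReal.ofReal K ^ 2 * ∫⁻ ξ, (‖ξ‖ₑ * ‖(𝓕 f : L2) ξ‖ₑ) ^ 2) := by
  -- Plancherel turns L² norms of differences u(· - v) - u into weighted integrals of |û|², so the
  -- pointwise hypothesis transfers to the Fourier side without differentiating `G`.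
  have hrel : ∀ (v : R3) (u : L2), eLpNorm (fun x => u (x - v) - u x) 2 volume ^ 2 =
      ∫⁻ ξ, ‖(waveSymbol v ξ - 1) * (𝓕 u : L2) ξ‖ₑ ^ 2 := by
    intro v u
    have e1 : (translate v u - u : L2) =ᵐ[volume] fun x => u (x - v) - u x := by
      filter_upwards [Lp.coeFn_sub (translate v u) u, coeFn_translate v u] with x h1 h2
      rw [h1, Pi.sub_apply, h2]
    rw [← eLpNorm_congr_ae e1, ← enorm_fourier, eLpNorm_two_sq]
    refine lintegral_congr_ae ?_
    filter_upwards [(mulRel_translate v u).sub (mulRel_one u)] with ξ h1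
    rw [h1]
  have hA : ∀ v : R3, ∫⁻ ξ, ‖(waveSymbol v ξ - 1) * (𝓕 G : L2) ξ‖ₑ ^ 2 ≤
      ENNReal.ofReal K ^ 2 * ∫⁻ ξ, ‖(waveSymbol v ξ - 1) * (𝓕 f : L2) ξ‖ₑ ^ 2 := by
    intro v
    rw [← hrel, ← hrel, ← mul_pow]
    gcongr
    exact eLpNorm_le_mul_eLpNorm_of_ae_le_mul (h v) 2
  set E := ∫⁻ ξ, (‖ξ‖ₑ * ‖(𝓕 f : L2) ξ‖ₑ) ^ 2
  set P : ℝ≥0∞ := ENNReal.ofReal (2 * Real.pi)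
  have hP : P ≠ 0 := by simp [P, Real.pi_pos]
  have hP' : P ≠ ⊤ := ENNReal.ofReal_ne_top
  -- Difference quotients with step 1/(n+1) in a unit direction: |e^{ia} - 1| ≤ |a| bounds the side
  -- of `f` uniformly in n, leaving Fatou for the side of `G`.
  have hB : ∀ v : R3, ‖v‖ = 1 → ∀ n : ℕ,
      ∫⁻ ξ, (‖((n : ℝ) + 1) • (waveSymbol (((n : ℝ) + 1)⁻¹ • v) ξ - 1)‖ₑ * ‖(𝓕 G : L2) ξ‖ₑ) ^ 2 ≤
        ENNReal.ofReal K ^ 2 * (P ^ 2 * E) := by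
    intro v hv n
    have hn : (0 : ℝ) < (n : ℝ) + 1 := by positivity
    have h2 : ∀ u : L2, ∫⁻ ξ, (‖((n : ℝ) + 1) • (waveSymbol (((n : ℝ) + 1)⁻¹ • v) ξ - 1)‖ₑ *
        ‖(𝓕 u : L2) ξ‖ₑ) ^ 2 = ‖(n : ℝ) + 1‖ₑ ^ 2 *
          ∫⁻ ξ, ‖(waveSymbol (((n : ℝ) + 1)⁻¹ • v) ξ - 1) * (𝓕 u : L2) ξ‖ₑ ^ 2 := by
      intro u
      rw [← lintegral_const_mul' _ _ (by finiteness)]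
      refine lintegral_congr fun ξ => ?_
      rw [enorm_smul, enorm_mul]; ring
    rw [h2]
    calc _ ≤ ‖(n : ℝ) + 1‖ₑ ^ 2 * (ENNReal.ofReal K ^ 2 *
          ∫⁻ ξ, ‖(waveSymbol (((n : ℝ) + 1)⁻¹ • v) ξ - 1) * (𝓕 f : L2) ξ‖ₑ ^ 2) := by
          gcongr; exact hA _
      _ = ENNReal.ofReal K ^ 2 * ∫⁻ ξ, (‖((n : ℝ) + 1) •
          (waveSymbol (((n : ℝ) + 1)⁻¹ • v) ξ - 1)‖ₑ * ‖(𝓕 f : L2) ξ‖ₑ) ^ 2 := by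
          rw [h2]; ring
      _ ≤ _ := by
        refine mul_le_mul_right ?_ _
        rw [← lintegral_const_mul' _ _ (ENNReal.pow_ne_top hP')]
        gcongr with ξ
        rw [← mul_pow, ← mul_assoc]
        gcongr
        rw [← ofReal_norm, ← ofReal_norm, ← ENNReal.ofReal_mul (by positivity)]
        refine ENNReal.ofReal_le_ofReal ?_
        rw [norm_smul, Real.norm_of_nonneg hn.le]
        have := norm_waveSymbol_sub_one_le (((n : ℝ) + 1)⁻¹ • v) ξ
        rw [norm_smul, Real.norm_of_nonneg (by positivity), hv, mul_one] at this
        calc _ ≤ ((n : ℝ) + 1) * (2 * Real.pi * (((n : ℝ) + 1)⁻¹ * ‖ξ‖)) := by gcongr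
          _ = _ := by field_simp
  have hC : ∀ v : R3, ‖v‖ = 1 → ∫⁻ ξ, (‖(inner ℝ v ξ : ℝ)‖ₑ * ‖(𝓕 G : L2) ξ‖ₑ) ^ 2 ≤
      ENNReal.ofReal K ^ 2 * E := by
    intro v hv
    have hlim : ∀ ξ, Filter.liminf (fun n : ℕ => (‖((n : ℝ) + 1) •
        (waveSymbol (((n : ℝ) + 1)⁻¹ • v) ξ - 1)‖ₑ * ‖(𝓕 G : L2) ξ‖ₑ) ^ 2) Filter.atTop =
        P ^ 2 * (‖(inner ℝ v ξ : ℝ)‖ₑ * ‖(𝓕 G : L2) ξ‖ₑ) ^ 2 := by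
      intro ξ
      refine Filter.Tendsto.liminf_eq ?_
      have h1 := ENNReal.Tendsto.mul_const (b := ‖(𝓕 G : L2) ξ‖ₑ) (tendsto_waveSymbol_slope v ξ)
        (Or.inr enorm_ne_top)
      have h2 := ((ENNReal.continuous_pow 2).tendsto _).comp h1
      refine (h2.congr fun n => rfl).trans_eq ?_
      rw [enorm_mul, ← mul_pow, ← mul_assoc]
      congr 4
      rw [← ofReal_norm, Real.norm_of_nonneg (by positivity)]
    have hmeas : ∀ n : ℕ, Measurable fun ξ => (‖((n : ℝ) + 1) •
        (waveSymbol (((n : ℝ) + 1)⁻¹ • v) ξ - 1)‖ₑ * ‖(𝓕 G : L2) ξ‖ₑ) ^ 2 := by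
      intro n
      have := (continuous_waveSymbol (((n : ℝ) + 1)⁻¹ • v)).measurable
      have := measurable_coe_L2 (𝓕 G : L2)
      fun_prop
    have hF := lintegral_liminf_le (μ := (volume : Measure R3)) (u := (Filter.atTop : Filter ℕ)) hmeas
    simp_rw [hlim] at hF
    rw [lintegral_const_mul' _ _ (by finiteness)] at hF
    have hF2 : P ^ 2 * ∫⁻ ξ, (‖(inner ℝ v ξ : ℝ)‖ₑ * ‖(𝓕 G : L2) ξ‖ₑ) ^ 2 ≤
        P ^ 2 * (ENNReal.ofReal K ^ 2 * E) := by
      refine hF.trans ?_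
      rw [mul_left_comm]
      exact Filter.liminf_le_of_le (by isBoundedDefault) fun b hb =>
        let ⟨n, hn⟩ := hb.exists; hn.trans (hB v hv n)
    exact (ENNReal.mul_le_mul_iff_right (pow_ne_zero 2 hP) (ENNReal.pow_ne_top hP')).1 hF2
  -- Summation over the three coordinate directions, each bounded by the whole energy of `f`; hence
  -- the factor 3.
  have hsplit : ∀ ξ : R3, (‖ξ‖ₑ * ‖(𝓕 G : L2) ξ‖ₑ) ^ 2 = ∑ i : Fin 3,
      (‖(inner ℝ (EuclideanSpace.single i (1 : ℝ)) ξ : ℝ)‖ₑ * ‖(𝓕 G : L2) ξ‖ₑ) ^ 2 := by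
    intro ξ
    simp_rw [mul_pow]
    rw [← Finset.sum_mul]
    congr 1
    simp only [EuclideanSpace.inner_single_left, map_one, one_mul]
    simp_rw [← ofReal_norm, ← ENNReal.ofReal_pow (norm_nonneg _)]
    rw [EuclideanSpace.norm_sq_eq, ENNReal.ofReal_sum_of_nonneg (fun i _ => by positivity)]
  simp_rw [hsplit]
  rw [lintegral_finsetSum]
  · calc _ ≤ ∑ i : Fin 3, ENNReal.ofReal K ^ 2 * E :=
          Finset.sum_le_sum fun i _ => hC _ (by simp)
      _ = _ := by simp
  · intro i _
    have := measurable_coe_L2 (𝓕 G : L2)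
    fun_prop

/-! ### Estimates for the nonlinearity -/

theorem continuous_nonlin {p : ℝ} (hp : 1 ≤ p) : Continuous (nonlin p) := by
  unfold nonlin
  exact (Complex.continuous_ofReal.comp (continuous_norm.rpow_const fun _ =>
    Or.inr (by linarith))).mul continuous_id

theorem norm_nonlin {p : ℝ} (z : ℂ) : ‖nonlin p z‖ = ‖z‖ ^ (p - 1) * ‖z‖ := by
  rw [nonlin, norm_mul, Complex.norm_real, Real.norm_of_nonneg (by positivity)]

/-- Bernoulli's inequality for (b/a)^q gives the stronger bound with the last factor `b` on the left
replaced by `a`. -/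
theorem rpow_sub_rpow_mul_le {a b q : ℝ} (hb : 0 ≤ b) (hab : b ≤ a) (hq : 1 ≤ q) :
    (a ^ q - b ^ q) * b ≤ q * a ^ q * (a - b) := by
  rcases hb.eq_or_lt with rfl | hb0
  · rw [mul_zero, sub_zero]; positivity
  have ha : 0 < a := hb0.trans_le hab
  have h := one_add_mul_self_le_rpow_one_add (s := b / a - 1) (p := q)
    (by linarith [div_nonneg hb ha.le]) hq
  rw [add_sub_cancel, Real.div_rpow hb ha.le, le_div_iff₀ (by positivity)] at h
  have h1 : (a ^ q - b ^ q) * a ≤ q * a ^ q * (a - b) := by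
    have : (1 + q * (b / a - 1)) * a ^ q * a = (a + q * (b - a)) * a ^ q := by
      field_simp
    nlinarith
  refine le_trans ?_ h1
  have : b ^ q ≤ a ^ q := Real.rpow_le_rpow hb hab (by linarith)
  exact mul_le_mul_of_nonneg_left hab (by linarith)

/-- By symmetry the larger modulus multiplies z - w. What is left is the difference of the powers
times the smaller modulus, which is the Bernoulli bound with exponent p - 1 ≥ 1. -/
theorem norm_nonlin_sub_le {p β : ℝ} (hp : 2 ≤ p) {z w : ℂ} (hz : ‖z‖ ≤ β) (hw : ‖w‖ ≤ β) :
    ‖nonlin p z - nonlin p w‖ ≤ p * β ^ (p - 1) * ‖z - w‖ := by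
  wlog hzw : ‖w‖ ≤ ‖z‖ generalizing z w
  · rw [norm_sub_rev, norm_sub_rev z w]; exact this hw hz (le_of_not_ge hzw)
  have e : nonlin p z - nonlin p w = ((‖z‖ ^ (p - 1) : ℝ) : ℂ) * (z - w) +
      ((‖z‖ ^ (p - 1) - ‖w‖ ^ (p - 1) : ℝ) : ℂ) * w := by
    simp only [nonlin]; push_cast; ring
  have hmono : ‖w‖ ^ (p - 1) ≤ ‖z‖ ^ (p - 1) :=
    Real.rpow_le_rpow (norm_nonneg _) hzw (by linarith)
  have hβ : ‖z‖ ^ (p - 1) ≤ β ^ (p - 1) := Real.rpow_le_rpow (norm_nonneg _) hz (by linarith)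
  have h1 := rpow_sub_rpow_mul_le (norm_nonneg w) hzw (show 1 ≤ p - 1 by linarith)
  have h2 : ‖z‖ - ‖w‖ ≤ ‖z - w‖ := norm_sub_norm_le z w
  have h0 : 0 ≤ ‖z‖ ^ (p - 1) := by positivity
  rw [e]
  refine (norm_add_le _ _).trans ?_
  rw [norm_mul, norm_mul, Complex.norm_real, Complex.norm_real, Real.norm_of_nonneg h0,
    Real.norm_of_nonneg (by linarith)]
  calc _ ≤ ‖z‖ ^ (p - 1) * ‖z - w‖ + (p - 1) * ‖z‖ ^ (p - 1) * ‖z - w‖ := by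
        have : (p - 1) * ‖z‖ ^ (p - 1) * (‖z‖ - ‖w‖) ≤ (p - 1) * ‖z‖ ^ (p - 1) * ‖z - w‖ :=
          mul_le_mul_of_nonneg_left h2 (mul_nonneg (by linarith) h0)
        linarith
    _ = p * ‖z‖ ^ (p - 1) * ‖z - w‖ := by ring
    _ ≤ _ := by gcongr

/-- Only `z` is bounded by β, so the Lipschitz bound is used on the ball of radius 2 max(β, |w|),
and the power of the maximum is split into a sum. -/
theorem norm_nonlin_add_sub_le {p β : ℝ} (hp : 2 ≤ p) {z w : ℂ} (hz : ‖z‖ ≤ β) :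
    ‖nonlin p (z + w) - nonlin p z‖ ≤
      p * 2 ^ (p - 1) * (β ^ (p - 1) * ‖w‖ + ‖w‖ ^ p) := by
  have hβ : 0 ≤ β := (norm_nonneg z).trans hz
  set M := max β ‖w‖
  have hM : 0 ≤ M := hβ.trans (le_max_left _ _)
  have h := norm_nonlin_sub_le (β := 2 * M) hp (z := z + w) (w := z)
    ((norm_add_le _ _).trans (by linarith [le_max_left β ‖w‖, le_max_right β ‖w‖]))
    (by linarith [le_max_left β ‖w‖])
  rw [add_sub_cancel_left, Real.mul_rpow zero_le_two hM] at h
  refine h.trans ?_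
  have hMp : M ^ (p - 1) ≤ β ^ (p - 1) + ‖w‖ ^ (p - 1) := by
    rcases max_choice β ‖w‖ with h | h
    · rw [show M = β from h]; linarith [Real.rpow_nonneg (norm_nonneg w) (p - 1)]
    · rw [show M = ‖w‖ from h]; linarith [Real.rpow_nonneg hβ (p - 1)]
  have hw : ‖w‖ ^ p = ‖w‖ ^ (p - 1) * ‖w‖ := by
    rw [← Real.rpow_add_one' (norm_nonneg _) (by linarith), sub_add_cancel]
  rw [hw, ← add_mul, ← mul_assoc, ← mul_assoc]
  gcongr

theorem eLpNorm_nonlin_add_sub_le {p : ℝ} (hp : 2 ≤ p) {z w : R3 → ℂ}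
    (hzt : eLpNorm z ⊤ volume ≠ ⊤) (hw : AEStronglyMeasurable w volume) :
    eLpNorm (fun x => nonlin p (z x + w x) - nonlin p (z x)) 2 volume ≤
      ENNReal.ofReal (p * 2 ^ (p - 1)) * (eLpNorm z ⊤ volume ^ (p - 1) * eLpNorm w 2 volume +
        eLpNorm w (ENNReal.ofReal (2 * p)) volume ^ p) := by
  set β := (eLpNorm z ⊤ volume).toReal
  have hβ : 0 ≤ β := ENNReal.toReal_nonneg
  have hz : ∀ᵐ x, ‖z x‖ ≤ β := by
    filter_upwards [ae_le_eLpNormEssSup (f := z) (μ := volume)] with x hx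
    rw [← toReal_enorm]
    exact ENNReal.toReal_mono hzt hx
  have e1 : eLpNorm (fun x => β ^ (p - 1) * ‖w x‖) 2 volume =
      eLpNorm z ⊤ volume ^ (p - 1) * eLpNorm w 2 volume := by
    have := eLpNorm_const_smul (β ^ (p - 1)) (fun x => ‖w x‖) 2 (volume : Measure R3)
    rw [eLpNorm_norm] at this
    refine this.trans ?_
    rw [Real.enorm_of_nonneg (by positivity), ← ENNReal.ofReal_rpow_of_nonneg hβ (by linarith),
      ENNReal.ofReal_toReal hzt]
  have e2 : eLpNorm (fun x => ‖w x‖ ^ p) 2 volume =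
      eLpNorm w (ENNReal.ofReal (2 * p)) volume ^ p := by
    rw [eLpNorm_norm_rpow w (by linarith), ENNReal.ofReal_mul zero_le_two]; simp
  have h1 : eLpNorm (fun x => nonlin p (z x + w x) - nonlin p (z x)) 2 volume ≤
      ENNReal.ofReal (p * 2 ^ (p - 1)) *
        eLpNorm ((fun x => β ^ (p - 1) * ‖w x‖) + fun x => ‖w x‖ ^ p) 2 volume := by
    refine eLpNorm_le_mul_eLpNorm_of_ae_le_mul ?_ 2
    filter_upwards [hz] with x hx
    refine (norm_nonlin_add_sub_le hp hx).trans ?_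
    rw [Pi.add_apply, Real.norm_of_nonneg (by positivity)]
  refine h1.trans ?_
  gcongr
  refine (eLpNorm_add_le (hw.norm.const_mul _) ?_ one_le_two).trans (by rw [e1, e2])
  exact (Real.continuous_rpow_const (by linarith)).comp_aestronglyMeasurable hw.norm

theorem memLp_nonlin_of_sup {p : ℝ} (hp : 2 ≤ p) {z : L2} (hzt : eLpNorm z ⊤ volume ≠ ⊤) :
    MemLp (fun x => nonlin p (z x)) 2 volume := by
  refine MemLp.of_le_mul (c := (eLpNorm z ⊤ volume).toReal ^ (p - 1)) (Lp.memLp z)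
    ((continuous_nonlin (by linarith)).comp_aestronglyMeasurable (Lp.memLp z).1) ?_
  filter_upwards [ae_le_eLpNormEssSup (f := z) (μ := volume)] with x hx
  rw [norm_nonlin]
  gcongr
  · linarith
  · rw [← toReal_enorm]
    exact ENNReal.toReal_mono hzt hx

/-! ### L² errors at frequency N -/

section

variable {s : ℝ} {η : R3 → ℝ}

theorem continuous_symbolI (hη : IsProfile s η) (N : ℝ) : Continuous (symbolI η N) :=
  hη.smooth.continuous.comp (continuous_const_smul _)

theorem abs_symbolI_le (hη : IsProfile s η) (N : ℝ) (ξ : R3) : |symbolI η N ξ| ≤ 1 := by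
  rw [symbolI, abs_of_pos (hη.pos _)]; exact hη.le_one _

/-- On 1/2 ≤ |ζ| ≤ 2 both |ζ| and η(ζ) ≥ 2^{-(1-s)} are at least 1/2, whence the 4; beyond, |ζ|η(ζ)
= |ζ|^s ≥ 1. Both cases use s ≥ 0. -/
theorem one_sub_cutoff_le (hη : IsProfile s η) (hs : 0 ≤ s) (ζ : R3) :
    1 - cutoff ζ ≤ 4 * (‖ζ‖ * η ζ) := by
  have h0 := cutoff_nonneg ζ
  rcases le_total ‖ζ‖ (1 / 2) with h | h
  · rw [cutoff_eq_one h, sub_self]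
    have := hη.pos ζ
    positivity
  rcases le_total ‖ζ‖ 2 with h2 | h2
  · obtain ⟨v, hv⟩ := exists_norm_eq R3 (show (0 : ℝ) ≤ 2 by norm_num)
    have h3 := hη.radial_antitone ζ v (by rw [hv]; exact h2)
    have h4 : (1 / 2 : ℝ) ≤ η v := by
      rw [hη.eq_rpow' hv.ge, hv]
      calc (1 / 2 : ℝ) = 2 ^ (-1 : ℝ) := by rw [Real.rpow_neg_one]; norm_num
        _ ≤ _ := Real.rpow_le_rpow_of_exponent_le one_le_two (by linarith)
    have : (1 / 2) * (1 / 2) ≤ ‖ζ‖ * η ζ := by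
      gcongr
      exact h4.trans h3
    linarith
  · have h3 : ‖ζ‖ * η ζ = ‖ζ‖ ^ s := by
      rw [hη.eq_rpow' h2]
      nth_rewrite 1 [← Real.rpow_one ‖ζ‖]
      rw [← Real.rpow_add (by linarith)]
      congr 1; ring
    have : 1 ≤ ‖ζ‖ ^ s := Real.one_le_rpow (by linarith) hs
    linarith

theorem abs_profile_sub_one_le (hη : IsProfile s η) (ζ : R3) : |η ζ - 1| ≤ ‖ζ‖ := by
  rcases le_total ‖ζ‖ 1 with h | h
  · rw [hη.eq_one ζ h, sub_self, abs_zero]; exact norm_nonneg _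
  · rw [abs_le]; constructor <;> linarith [hη.pos ζ, hη.le_one ζ]

/-- The high frequency part of `f` in `L²`. -/
theorem eLpNorm_high_le (hη : IsProfile s η) (hs : 0 ≤ s) {N : ℝ} (hN : 0 < N) {f A g : L2}
    (hA : MulRel (sym (symbolDI 1 η N)) f A) (hg : MulRel (sym fun ξ => 1 - cutoff (N⁻¹ • ξ)) f g) :
    eLpNorm g 2 volume ≤ ENNReal.ofReal (4 * N⁻¹) * eLpNorm A 2 volume := by
  refine hg.eLpNorm_le hA fun ξ => ?_
  simp only [sym, Complex.norm_real, symbolDI, symbolI, Real.rpow_one]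
  generalize (2 * Real.pi) • ξ = ξ
  have h := one_sub_cutoff_le hη hs (N⁻¹ • ξ)
  have h1 := cutoff_le_one (N⁻¹ • ξ)
  have h2 := (hη.pos (N⁻¹ • ξ)).le
  rw [norm_smul, Real.norm_of_nonneg (by positivity)] at h
  rw [Real.norm_of_nonneg (by linarith), Real.norm_of_nonneg (by positivity)]
  linarith

/-- The error of replacing `I G` by `G`, for `G` a Lipschitz image of the low frequencies. -/
theorem eLpNorm_symbolI_sub_le (hη : IsProfile s η) {N : ℝ} (hN : 0 < N) {f A fl G GI : L2}
    (hA : MulRel (sym (symbolDI 1 η N)) f A) (hfl : MulRel (sym fun ξ => cutoff (N⁻¹ • ξ)) f fl)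
    (hG : MulRel (sym (symbolI η N)) G GI) {K : ℝ}
    (h : ∀ v : R3, ∀ᵐ x, ‖G (x - v) - G x‖ ≤ K * ‖fl (x - v) - fl x‖) :
    eLpNorm (GI - G : L2) 2 volume ≤
      2 * ENNReal.ofReal K * ENNReal.ofReal N⁻¹ * eLpNorm A 2 volume := by
  set P : ℝ≥0∞ := ENNReal.ofReal (2 * Real.pi)
  have h1 : eLpNorm (GI - G : L2) 2 volume ^ 2 ≤
      (ENNReal.ofReal N⁻¹ * P) ^ 2 * ∫⁻ ξ, (‖ξ‖ₑ * ‖(𝓕 G : L2) ξ‖ₑ) ^ 2 := by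
    rw [← enorm_fourier, eLpNorm_two_sq, ← lintegral_const_mul' _ _ (by finiteness)]
    refine lintegral_mono_ae ?_
    filter_upwards [hG.sub (mulRel_one G)] with ξ h1
    rw [h1, enorm_mul, ← mul_pow, ← mul_assoc]
    gcongr
    rw [← ofReal_norm, ← ofReal_norm, ← ENNReal.ofReal_mul (by positivity),
      ← ENNReal.ofReal_mul (by positivity)]
    refine ENNReal.ofReal_le_ofReal ?_
    have h2 := abs_profile_sub_one_le hη (N⁻¹ • (2 * Real.pi) • ξ)
    rw [norm_smul, norm_smul, Real.norm_of_nonneg (by positivity),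
      Real.norm_of_nonneg (by positivity)] at h2
    rw [sym, symbolI, ← Complex.ofReal_one, ← Complex.ofReal_sub, Complex.norm_real,
      Real.norm_eq_abs]
    linarith
  have h2 := lintegral_fourier_gradient_le h
  have h3 : P ^ 2 * ∫⁻ ξ, (‖ξ‖ₑ * ‖(𝓕 fl : L2) ξ‖ₑ) ^ 2 ≤ eLpNorm A 2 volume ^ 2 := by
    rw [← enorm_fourier A, eLpNorm_two_sq, ← lintegral_const_mul' _ _ (by finiteness)]
    refine lintegral_mono_ae ?_
    filter_upwards [hA, hfl] with ξ h1 h2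
    rw [h1, h2, ← mul_pow, enorm_mul, enorm_mul, ← mul_assoc, ← mul_assoc]
    gcongr
    rw [← ofReal_norm, ← ofReal_norm, ← ofReal_norm, ← ENNReal.ofReal_mul (by positivity),
      ← ENNReal.ofReal_mul (by positivity)]
    refine ENNReal.ofReal_le_ofReal ?_
    simp only [sym, Complex.norm_real, symbolDI, symbolI, Real.rpow_one]
    have e := cutoff_mul_profile hη (N⁻¹ • (2 * Real.pi) • ξ)
    have h0 := cutoff_nonneg (N⁻¹ • (2 * Real.pi) • ξ)
    have h3 := cutoff_le_one (N⁻¹ • (2 * Real.pi) • ξ)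
    have h4 := hη.pos (N⁻¹ • (2 * Real.pi) • ξ)
    rw [Real.norm_of_nonneg h0, Real.norm_of_nonneg (by positivity), norm_smul,
      Real.norm_of_nonneg (by positivity), ← e]
    gcongr
    nlinarith
  -- The factor 3 of the gradient bound is rounded up to the square 4 = 2². The (2π)² from |η - 1| ≤
  -- |ζ| is absorbed by `A`, whose symbol contains 2π|ξ|.
  have h4 : eLpNorm (GI - G : L2) 2 volume ^ 2 ≤
      (2 * ENNReal.ofReal K * ENNReal.ofReal N⁻¹ * eLpNorm A 2 volume) ^ 2 := by
    calc _ ≤ (ENNReal.ofReal N⁻¹ * P) ^ 2 * (3 * (ENNReal.ofReal K ^ 2 *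
          ∫⁻ ξ, (‖ξ‖ₑ * ‖(𝓕 fl : L2) ξ‖ₑ) ^ 2)) := h1.trans (by gcongr)
      _ = 3 * (ENNReal.ofReal N⁻¹ ^ 2 * ENNReal.ofReal K ^ 2 *
          (P ^ 2 * ∫⁻ ξ, (‖ξ‖ₑ * ‖(𝓕 fl : L2) ξ‖ₑ) ^ 2)) := by ring
      _ ≤ 4 * (ENNReal.ofReal N⁻¹ ^ 2 * ENNReal.ofReal K ^ 2 * eLpNorm A 2 volume ^ 2) := by
        gcongr
        norm_num
      _ = _ := by ring
  exact (ENNReal.pow_le_pow_left_iff two_ne_zero).1 h4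

end

/-! ### The commutator at a fixed time -/

/-- The commutator estimate at a fixed time. -/
theorem exists_commutatorNorm_le {p s : ℝ} {η : R3 → ℝ} (hp : 2 ≤ p) (hs : 0 ≤ s) (hs' : s < 1)
    (hη : IsProfile s η) {b₁ r₁ b₂ : ℝ} (hr₁ : 1 < r₁) (hb₁ : b₁ < 3 / r₁) (hb₂ : 1 - s < b₂) :
    ∃ C : ℝ≥0, ∀ N : ℝ, 0 < N → ∀ f A F₁ F₂ : L2, MulRel (sym (symbolDI 1 η N)) f A →
      MulRel (sym (symbolDI b₁ η N)) f F₁ → MulRel (sym (symbolDI b₂ η N)) f F₂ →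
      eLpNorm F₁ (ENNReal.ofReal r₁) volume < ⊤ →
      eLpNorm F₂ (ENNReal.ofReal (2 * p)) volume < ⊤ →
      commutatorNorm p (symbolI η N) f ≤
        C * (ENNReal.ofReal N⁻¹ * eLpNorm A 2 volume * (ENNReal.ofReal (N ^ (3 / r₁ - b₁)) *
              eLpNorm F₁ (ENNReal.ofReal r₁) volume) ^ (p - 1) +
            (ENNReal.ofReal (N ^ (-b₂)) *
              eLpNorm F₂ (ENNReal.ofReal (2 * p)) volume) ^ p) := by
  obtain ⟨C₁, hC₁⟩ := exists_low_sup_bound hη hr₁ hb₁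
  obtain ⟨C₂, hC₂⟩ := exists_high_bound hη (r := 2 * p) (by linarith) hb₂
  obtain ⟨C₃, hC₃⟩ := exists_Lr_bound hη.smooth (δ := 1 - s) (by linarith)
    (fun ξ hξ => hη.eq_rpow' hξ) (r := 2 * p) (by linarith)
  let c : ℝ≥0 := (p * 2 ^ (p - 1)).toNNReal
  -- 10 = 4 + 2 + 4: the constant of `eLpNorm_high_le` in each of the two differences of
  -- nonlinearities, and the 2 of `eLpNorm_symbolI_sub_le`.
  refine ⟨10 * c * C₁ ^ (p - 1) + c * (1 + C₃ ^ p) * C₂ ^ p, ?_⟩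
  intro N hN f A F₁ F₂ hA hF₁ hF₂ hF₁t hF₂t
  have hcutm : Measurable fun ξ => cutoff (N⁻¹ • ξ) :=
    (contDiff_cutoff.continuous.comp (continuous_const_smul _)).measurable
  obtain ⟨fl, hfl⟩ := exists_mulRel hcutm (c := 1) (fun ξ => by
    rw [abs_of_nonneg (cutoff_nonneg _)]; exact cutoff_le_one _) f
  obtain ⟨g, hg⟩ := exists_mulRel (σ := fun ξ => 1 - cutoff (N⁻¹ • ξ)) (measurable_const.sub hcutm)
    (c := 1) (fun ξ => by
      rw [abs_le]
      constructor <;> linarith [cutoff_nonneg (N⁻¹ • ξ), cutoff_le_one (N⁻¹ • ξ)]) f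
  have hI : ∀ u : L2, ∃ v, MulRel (sym (symbolI η N)) u v := fun u =>
    exists_mulRel (continuous_symbolI hη N).measurable (abs_symbolI_le hη N) u
  obtain ⟨g', hg'⟩ := hI g
  have hf : f = fl + g := by
    refine (mulRel_one f).unique ((hfl.add hg).congr (Filter.Eventually.of_forall fun ξ => ?_))
    simp [sym]
  -- η = 1 on the support of the cutoff, so I fixes `fl` and If = fl + Ig.
  have hb : MulRel (sym (symbolI η N)) f (fl + g') := by
    refine (hfl.add (hg.comp hg')).congr (Filter.Eventually.of_forall fun ξ => ?_)
    simp only [sym, symbolI, ← Complex.ofReal_mul, ← Complex.ofReal_add]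
    congr 1
    linear_combination - cutoff_mul_profile hη (N⁻¹ • (2 * Real.pi) • ξ)
  have hfl_sup := hC₁ N hN f F₁ fl hF₁ hfl
  have hg_hi := hC₂ N hN f F₂ g hF₂ hg
  have hg'_hi := hC₃ N hN g g' hg'
  have hg2 := eLpNorm_high_le hη hs hN hA hg
  have hg'2 : eLpNorm g' 2 volume ≤ eLpNorm g 2 volume := by
    have := hg'.eLpNorm_le (mulRel_one g) (c := 1) (fun ξ => by
      simpa [sym] using abs_symbolI_le hη N _)
    simpa using this
  generalize hX : ENNReal.ofReal (N ^ (3 / r₁ - b₁)) *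
    eLpNorm F₁ (ENNReal.ofReal r₁) volume = X at *
  generalize hY : ENNReal.ofReal (N ^ (-b₂)) *
    eLpNorm F₂ (ENNReal.ofReal (2 * p)) volume = Y at *
  have hXt : X ≠ ⊤ := hX ▸ ENNReal.mul_ne_top ENNReal.ofReal_ne_top hF₁t.ne
  have hYt : Y ≠ ⊤ := hY ▸ ENNReal.mul_ne_top ENNReal.ofReal_ne_top hF₂t.ne
  rw [mul_assoc, hX] at hfl_sup
  rw [mul_assoc, hY] at hg_hi
  have hflt : eLpNorm fl ⊤ volume ≠ ⊤ :=
    ne_top_of_le_ne_top (ENNReal.mul_ne_top ENNReal.coe_ne_top hXt) hfl_sup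
  have hgt : eLpNorm g (ENNReal.ofReal (2 * p)) volume ≠ ⊤ :=
    ne_top_of_le_ne_top (ENNReal.mul_ne_top ENNReal.coe_ne_top hYt) hg_hi
  set β := eLpNorm fl ⊤ volume
  have hβt : β ^ (p - 1) ≠ ⊤ := ENNReal.rpow_ne_top_of_nonneg (by linarith) hflt
  have hd := eLpNorm_nonlin_add_sub_le hp hflt (Lp.memLp g).1
  have hd' := eLpNorm_nonlin_add_sub_le hp hflt (Lp.memLp g').1
  rw [show ENNReal.ofReal (p * 2 ^ (p - 1)) = (c : ℝ≥0∞) from rfl] at hd hd'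
  have hcont : Continuous (nonlin p) := continuous_nonlin (by linarith)
  -- Finiteness of the two norms is used here: the sup bound on `fl` puts F(fl) in L², and g ∈
  -- L^{2p} then puts F(f) in L², so that I acts on both as an L² multiplier.
  have hGm := memLp_nonlin_of_sup hp hflt
  have hfae : f =ᵐ[volume] fun x => fl x + g x := by
    have := Lp.coeFn_add fl g
    rw [← hf] at this; exact this
  have hdm : MemLp (fun x => nonlin p (fl x + g x) - nonlin p (fl x)) 2 volume := by
    refine ⟨(hcont.comp_aestronglyMeasurable ((Lp.memLp fl).1.add (Lp.memLp g).1)).sub hGm.1, ?_⟩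
    refine hd.trans_lt (ENNReal.mul_lt_top ENNReal.coe_lt_top (ENNReal.add_lt_top.2
      ⟨ENNReal.mul_lt_top hβt.lt_top (Lp.memLp g).2, ?_⟩))
    exact ENNReal.rpow_lt_top_of_nonneg (by linarith) hgt
  have hHm : MemLp (fun x => nonlin p (f x)) 2 volume := by
    refine (memLp_congr_ae ?_).1 (hdm.add hGm)
    filter_upwards [hfae] with x hx
    rw [hx, Pi.add_apply, sub_add_cancel]
  set G : L2 := hGm.toLp _
  set H : L2 := hHm.toLp _
  have hGae := hGm.coeFn_toLp
  have hHae := hHm.coeFn_toLp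
  obtain ⟨a, ha⟩ := hI H
  obtain ⟨GI, hGI⟩ := hI G
  have hHG : eLpNorm (H - G : L2) 2 volume ≤
      c * (β ^ (p - 1) * eLpNorm g 2 volume +
        eLpNorm g (ENNReal.ofReal (2 * p)) volume ^ p) := by
    refine (le_of_eq (eLpNorm_congr_ae ?_)).trans hd
    filter_upwards [Lp.coeFn_sub H G, hGae, hHae, hfae] with x h1 h2 h3 h4
    rw [h1, Pi.sub_apply, h2, h3, h4]
  have hIHG : eLpNorm (a - GI : L2) 2 volume ≤ eLpNorm (H - G : L2) 2 volume := by
    have := (ha.sub_left hGI).eLpNorm_le (mulRel_one _) (c := 1) (fun ξ => by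
      simpa [sym] using abs_symbolI_le hη N _)
    simpa using this
  have hGIG : eLpNorm (GI - G : L2) 2 volume ≤
      2 * (c * β ^ (p - 1)) * ENNReal.ofReal N⁻¹ * eLpNorm A 2 volume := by
    have hsup : ∀ᵐ x, ‖fl x‖ ≤ β.toReal := by
      filter_upwards [ae_le_eLpNormEssSup (f := fl) (μ := volume)] with x hx
      rw [← toReal_enorm]
      exact ENNReal.toReal_mono hflt hx
    have := eLpNorm_symbolI_sub_le hη hN hA hfl hGI (K := p * β.toReal ^ (p - 1)) (fun v => by
      have q := (measurePreserving_sub_right (volume : Measure R3) v).quasiMeasurePreserving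
      filter_upwards [hGae, q.ae hGae, hsup, q.ae hsup] with x h1 h2 h3 h4
      rw [h1, h2]
      exact norm_nonlin_sub_le hp h4 h3)
    refine this.trans ?_
    have e : ENNReal.ofReal (p * β.toReal ^ (p - 1)) ≤ c * β ^ (p - 1) := by
      rw [ENNReal.ofReal_mul (by linarith), ← ENNReal.ofReal_rpow_of_nonneg ENNReal.toReal_nonneg
        (by linarith), ENNReal.ofReal_toReal hflt]
      gcongr
      refine ENNReal.ofReal_le_ofReal ?_
      have : (1 : ℝ) ≤ 2 ^ (p - 1) := Real.one_le_rpow one_le_two (by linarith)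
      nlinarith
    gcongr
  have hGb : eLpNorm (fun x => nonlin p (fl x + g' x) - nonlin p (fl x)) 2 volume ≤ _ := hd'
  have hcomm : commutatorNorm p (symbolI η N) f ≤
      eLpNorm (fun x => a x - nonlin p ((fl + g' : L2) x)) 2 volume := by
    refine iInf₂_le_of_le a (fl + g' : L2) (iInf₂_le_of_le ?_ hb.isMultiplierFunction le_rfl)
    exact ⟨H, (represents_coe H).congr hHae, ha.isMultiplierFunction⟩
  have htri : eLpNorm (fun x => a x - nonlin p ((fl + g' : L2) x)) 2 volume ≤
      eLpNorm (a - GI : L2) 2 volume + eLpNorm (GI - G : L2) 2 volume +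
        eLpNorm (fun x => nonlin p (fl x + g' x) - nonlin p (fl x)) 2 volume := by
    have e : (fun x => a x - nonlin p ((fl + g' : L2) x)) =ᵐ[volume]
        (⇑(a - GI : L2) + ⇑(GI - G : L2)) -
          fun x => nonlin p (fl x + g' x) - nonlin p (fl x) := by
      filter_upwards [Lp.coeFn_sub a GI, Lp.coeFn_sub GI G, hGae, Lp.coeFn_add fl g']
        with x h1 h2 h3 h4
      rw [Pi.sub_apply, Pi.add_apply, h1, h2, Pi.sub_apply, Pi.sub_apply, h3, h4, Pi.add_apply]
      ring
    rw [eLpNorm_congr_ae e]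
    refine (eLpNorm_sub_le ((Lp.memLp _).1.add (Lp.memLp _).1) ?_ one_le_two).trans ?_
    · exact (hcont.comp_aestronglyMeasurable ((Lp.memLp fl).1.add (Lp.memLp g').1)).sub hGm.1
    · gcongr
      exact eLpNorm_add_le (Lp.memLp _).1 (Lp.memLp _).1 one_le_two
  have hN4 : ENNReal.ofReal (4 * N⁻¹) = 4 * ENNReal.ofReal N⁻¹ := by
    rw [ENNReal.ofReal_mul (by norm_num)]; simp
  rw [hN4] at hg2
  have hp0 : 0 ≤ p := by linarith
  have hp1 : 0 ≤ p - 1 := by linarith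
  have hβX : β ^ (p - 1) ≤ (C₁ : ℝ≥0∞) ^ (p - 1) * X ^ (p - 1) := by
    rw [← ENNReal.mul_rpow_of_nonneg _ _ hp1]
    gcongr
  have hgY : eLpNorm g (ENNReal.ofReal (2 * p)) volume ^ p ≤ (C₂ : ℝ≥0∞) ^ p * Y ^ p := by
    rw [← ENNReal.mul_rpow_of_nonneg _ _ hp0]
    gcongr
  have hg'Y : eLpNorm g' (ENNReal.ofReal (2 * p)) volume ^ p ≤
      (C₃ : ℝ≥0∞) ^ p * ((C₂ : ℝ≥0∞) ^ p * Y ^ p) := by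
    refine le_trans ?_ (mul_le_mul_right hgY _)
    rw [← ENNReal.mul_rpow_of_nonneg _ _ hp0]
    gcongr
  set n := ENNReal.ofReal N⁻¹
  set α := eLpNorm A 2 volume
  calc commutatorNorm p (symbolI η N) f
      ≤ c * (β ^ (p - 1) * (4 * n * α) + (C₂ : ℝ≥0∞) ^ p * Y ^ p) +
          2 * (c * β ^ (p - 1)) * n * α +
          c * (β ^ (p - 1) * (4 * n * α) + (C₃ : ℝ≥0∞) ^ p * ((C₂ : ℝ≥0∞) ^ p * Y ^ p)) := by
        refine (hcomm.trans htri).trans (add_le_add (add_le_add ?_ hGIG) (hGb.trans ?_))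
        · exact (hIHG.trans hHG).trans (by gcongr)
        · gcongr
          exact hg'2.trans hg2
    _ = 10 * c * β ^ (p - 1) * (n * α) +
          c * (1 + (C₃ : ℝ≥0∞) ^ p) * (C₂ : ℝ≥0∞) ^ p * Y ^ p := by ring
    _ ≤ 10 * c * ((C₁ : ℝ≥0∞) ^ (p - 1) * X ^ (p - 1)) * (n * α) +
          c * (1 + (C₃ : ℝ≥0∞) ^ p) * (C₂ : ℝ≥0∞) ^ p * Y ^ p := by gcongr
    _ = (10 * c * (C₁ : ℝ≥0∞) ^ (p - 1)) * (n * α * X ^ (p - 1)) +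
          (c * (1 + (C₃ : ℝ≥0∞) ^ p) * (C₂ : ℝ≥0∞) ^ p) * Y ^ p := by ring
    _ ≤ _ := by
      have e : ((10 * c * C₁ ^ (p - 1) + c * (1 + C₃ ^ p) * C₂ ^ p : ℝ≥0) : ℝ≥0∞) =
          10 * c * (C₁ : ℝ≥0∞) ^ (p - 1) + c * (1 + (C₃ : ℝ≥0∞) ^ p) * (C₂ : ℝ≥0∞) ^ p := by
        push_cast
        rw [ENNReal.coe_rpow_of_nonneg _ hp1, ENNReal.coe_rpow_of_nonneg _ hp0,
          ENNReal.coe_rpow_of_nonneg _ hp0]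
      rw [e]
      refine le_trans ?_ (mul_add _ _ _).ge
      exact add_le_add (mul_le_mul' le_self_add le_rfl) (mul_le_mul' le_add_self le_rfl)

/-! ### Continuity and measurability in time -/

theorem mulRel_bessel {s : ℝ} {f u : L2}
    (h : TemperedDistribution.besselPotential R3 ℂ s (f : 𝓢'(R3, ℂ)) = (u : 𝓢'(R3, ℂ))) :
    MulRel (fun ξ => (((1 + ‖ξ‖ ^ 2) ^ (s / 2) : ℝ) : ℂ)) f u := by
  have h1 := congrArg (fun T : 𝓢'(R3, ℂ) => 𝓕 T) h
  simp only [TemperedDistribution.fourier_besselPotential_eq_smulLeftCLM_fourier_apply] at h1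
  have hg : (fun ξ : R3 => (((1 + ‖ξ‖ ^ 2) ^ (s / 2) : ℝ) : ℂ)).HasTemperateGrowth := by fun_prop
  have h2 : Represents (fun ξ => (((1 + ‖ξ‖ ^ 2) ^ (s / 2) : ℝ) : ℂ) * (𝓕 f : L2) ξ)
      (𝓕 (u : 𝓢'(R3, ℂ))) := by
    rw [← h1]
    refine ⟨hg.1.continuous.aestronglyMeasurable.mul (Lp.memLp _).1, fun φ => ?_⟩
    have h3 := (represents_fourier f).2
      (SchwartzMap.smulLeftCLM ℂ (fun ξ : R3 => (((1 + ‖ξ‖ ^ 2) ^ (s / 2) : ℝ) : ℂ)) φ)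
    have e : ∀ ξ, SchwartzMap.smulLeftCLM ℂ
        (fun ξ : R3 => (((1 + ‖ξ‖ ^ 2) ^ (s / 2) : ℝ) : ℂ)) φ ξ * (𝓕 f : L2) ξ =
        φ ξ * ((((1 + ‖ξ‖ ^ 2) ^ (s / 2) : ℝ) : ℂ) * (𝓕 f : L2) ξ) := by
      intro ξ
      rw [SchwartzMap.smulLeftCLM_apply_apply hg, smul_eq_mul]; ring
    simp only [e] at h3
    exact h3
  exact (represents_fourier u).ae_eq h2

/-- Up to 2N the power |ζ|^a is at most 2N; beyond, the symbol is N^{1-s}|ζ|^{a-(1-s)} ≤ N|ζ|^s. The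
Bessel weight has no 2π in it, whence (2π)^s. Growth in N is harmless because only qualitative
continuity in time is drawn from this. -/
theorem abs_symbolDI_le {s : ℝ} {η : R3 → ℝ} (hη : IsProfile s η) (hs : 0 ≤ s)
    {a N : ℝ} (ha : 0 ≤ a) (ha' : a ≤ 1) (hN : 1 ≤ N) (ξ : R3) :
    |symbolDI a η N ((2 * Real.pi) • ξ)| ≤
      (2 * N + N * (2 * Real.pi) ^ s) * (1 + ‖ξ‖ ^ 2) ^ (s / 2) := by
  have hN0 : 0 < N := by linarith
  have h1 : (1 : ℝ) ≤ (1 + ‖ξ‖ ^ 2) ^ (s / 2) :=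
    Real.one_le_rpow (by nlinarith [sq_nonneg ‖ξ‖]) (by linarith)
  have h2 : ‖ξ‖ ^ s ≤ (1 + ‖ξ‖ ^ 2) ^ (s / 2) := by
    have : ‖ξ‖ ^ s = (‖ξ‖ ^ 2) ^ (s / 2) := by
      rw [← Real.rpow_natCast, ← Real.rpow_mul (norm_nonneg _)]; congr 1; push_cast; ring
    rw [this]
    exact Real.rpow_le_rpow (by positivity) (by linarith) (by linarith)
  have hpi : 0 ≤ (2 * Real.pi) ^ s := by positivity
  have hζ : ‖(2 * Real.pi) • ξ‖ = 2 * Real.pi * ‖ξ‖ := by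
    rw [norm_smul, Real.norm_of_nonneg (by positivity)]
  have hζs : ‖(2 * Real.pi) • ξ‖ ^ s ≤ (2 * Real.pi) ^ s * (1 + ‖ξ‖ ^ 2) ^ (s / 2) := by
    rw [hζ, Real.mul_rpow (by positivity) (norm_nonneg _)]; gcongr
  generalize (2 * Real.pi) • ξ = ζ at *
  have hpos := hη.pos (N⁻¹ • ζ)
  rw [symbolDI, symbolI, abs_of_nonneg (by positivity)]
  rcases le_total ‖ζ‖ (2 * N) with h | h
  · calc ‖ζ‖ ^ a * η (N⁻¹ • ζ) ≤ (2 * N) ^ a * 1 := by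
          gcongr; exact hη.le_one _
      _ ≤ (2 * N) ^ (1 : ℝ) * 1 := by
          gcongr; linarith
      _ ≤ (2 * N + N * (2 * Real.pi) ^ s) * 1 := by
          rw [Real.rpow_one]; gcongr; nlinarith
      _ ≤ _ := by gcongr
  · have hζ0 : 0 < ‖ζ‖ := by linarith
    have hn : ‖N⁻¹ • ζ‖ = N⁻¹ * ‖ζ‖ := by rw [norm_smul, Real.norm_of_nonneg (by positivity)]
    have h3 : 2 ≤ ‖N⁻¹ • ζ‖ := by
      rw [hn, inv_mul_eq_div, le_div_iff₀ hN0]; exact h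
    have h4 : ‖ζ‖ ^ a * η (N⁻¹ • ζ) = N ^ (1 - s) * ‖ζ‖ ^ (a - (1 - s)) := by
      rw [hη.eq_rpow' h3, hn, Real.mul_rpow (by positivity) hζ0.le, Real.inv_rpow hN0.le,
        Real.rpow_neg hN0.le, inv_inv, sub_eq_add_neg a, Real.rpow_add hζ0]
      ring
    rw [h4]
    calc N ^ (1 - s) * ‖ζ‖ ^ (a - (1 - s)) ≤ N ^ (1 : ℝ) * ‖ζ‖ ^ s := by
          gcongr <;> linarith
      _ ≤ N * ((2 * Real.pi) ^ s * (1 + ‖ξ‖ ^ 2) ^ (s / 2)) := by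
          rw [Real.rpow_one]; gcongr
      _ ≤ _ := by nlinarith

theorem measurable_symbolDI {s : ℝ} {η : R3 → ℝ} (hη : IsProfile s η) (a N : ℝ) :
    Measurable (symbolDI a η N) :=
  (measurable_norm.pow_const a).mul (continuous_symbolI hη N).measurable

/-- D^a I is a bounded multiplier composed with the Bessel potential of order s, so it inherits the
continuity of the H^s path. -/
theorem IsEnergyPath.exists_continuousOn {s : ℝ} {η : R3 → ℝ} (hη : IsProfile s η) (hs : 0 ≤ s)
    {a N : ℝ} (ha : 0 ≤ a) (ha' : a ≤ 1) (hN : 1 ≤ N) {J : Set ℝ} {w : ℝ → L2}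
    {w' : ℝ → 𝓢'(R3, ℂ)} (h : IsEnergyPath s J (fun t => (w t : 𝓢'(R3, ℂ))) w') :
    ∃ G : ℝ → L2, ContinuousOn G J ∧ ∀ t ∈ J, MulRel (sym (symbolDI a η N)) (w t) (G t) := by
  obtain ⟨⟨U, hU, hUw⟩, -⟩ := h
  let ν : R3 → ℂ := fun ξ =>
    ((symbolDI a η N ((2 * Real.pi) • ξ) * (1 + ‖ξ‖ ^ 2) ^ (-(s / 2)) : ℝ) : ℂ)
  have hν : MemLp ν ⊤ (volume : Measure R3) := by
    refine memLp_top_of_bound (C := 2 * N + N * (2 * Real.pi) ^ s) ?_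
      (Filter.Eventually.of_forall fun ξ => ?_)
    · refine (Complex.measurable_ofReal.comp (Measurable.mul ?_ ?_)).aestronglyMeasurable
      · exact (measurable_symbolDI hη a N).comp (measurable_const_smul _)
      · fun_prop
    · simp only [ν, Complex.norm_real, norm_mul, Real.norm_eq_abs]
      have h1 : 0 < (1 + ‖ξ‖ ^ 2) ^ (s / 2) := by positivity
      rw [Real.rpow_neg (by positivity), abs_inv, abs_of_pos h1, ← div_eq_mul_inv,
        div_le_iff₀ h1]
      exact abs_symbolDI_le hη hs ha ha' hN ξ
  refine ⟨fun t => mulCLM (hν.toLp _) (U t), (mulCLM _).continuous.comp_continuousOn hU,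
    fun t ht => ?_⟩
  refine ((mulRel_bessel (hUw t ht)).comp (mulRel_mulCLM hν (U t))).congr
    (Filter.Eventually.of_forall fun ξ => ?_)
  simp only [ν, sym, ← Complex.ofReal_mul]
  congr 1
  rw [mul_assoc, ← Real.rpow_add (by positivity)]
  simp

/-- The L^r norm need not be continuous on L², but it is lower semicontinuous, which suffices for
measurability. -/
theorem aemeasurable_eLpNorm_of_continuousOn {G : ℝ → L2} {J : Set ℝ} (hJ : MeasurableSet J)
    (hG : ContinuousOn G J) (r : ℝ≥0∞) :
    AEMeasurable (fun t => eLpNorm (G t) r volume) (volume.restrict J) := by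
  refine aemeasurable_restrict_of_measurable_subtype hJ ?_
  have : LowerSemicontinuous ((fun u : L2 => eLpNorm u r volume) ∘ J.domRestrict G) :=
    LowerSemicontinuous.comp (f := fun u : L2 => eLpNorm u r volume)
      (lowerSemicontinuous_eLpNorm r) (continuousOn_iff_continuous_domRestrict.1 hG)
  exact this.measurable

theorem eLpNorm_le_Z {κ m N : ℝ} {η : R3 → ℝ} {J : Set ℝ} (hJ : MeasurableSet J) {w : ℝ → L2}
    {w' : ℝ → 𝓢'(R3, ℂ)} {q r : ℝ≥0∞} (hm : m ∈ Set.Icc (0 : ℝ) 1)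
    (hadm : IsWaveAdmissible κ m q r) {G : ℝ → L2}
    (hG : ∀ t ∈ J, MulRel (sym (symbolDI (1 - m) η N)) (w t) (G t)) :
    eLpNorm (fun t => eLpNorm (G t) r volume) q (volume.restrict J) ≤
      Z κ η N J (fun t => (w t : 𝓢'(R3, ℂ))) w' := by
  have h1 : eLpNorm (fun t => eLpNorm (G t) r volume) q (volume.restrict J) ≤
      mixedNorm J q r (symbolDI (1 - m) η N) (fun t => (w t : 𝓢'(R3, ℂ))) := by
    refine eLpNorm_mono_enorm_ae ?_
    filter_upwards [ae_restrict_mem hJ] with t ht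
    exact (hG t ht).eLpNorm_le_multiplierNorm r
  refine h1.trans (le_trans ?_ (le_iSup₂_of_le m hm le_rfl))
  exact le_iSup₂_of_le q r (le_iSup_of_le hadm le_add_self)

/-! ### Hölder in time, the threshold and the admissible pairs -/

theorem isWaveAdmissible_ofReal {κ m q r : ℝ} (hq : 2 < q) (hr : 2 ≤ r)
    (h1 : q⁻¹ + r⁻¹ ≤ 2⁻¹) (h2 : q⁻¹ + 3 * r⁻¹ = 3 / 2 - m) (hm : m ≠ 1) :
    IsWaveAdmissible κ m (ENNReal.ofReal q) (ENNReal.ofReal r) := by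
  have hq0 : 0 < q := by linarith
  have hr0 : 0 < r := by linarith
  have e2 : (2 : ℝ≥0∞) = ENNReal.ofReal 2 := by simp
  refine ⟨?_, ?_, ENNReal.ofReal_ne_top, ?_, ?_, fun h => absurd h hm⟩
  · rw [e2]; exact (ENNReal.ofReal_lt_ofReal_iff hq0).2 hq
  · rw [e2]; exact ENNReal.ofReal_le_ofReal hr
  · rw [e2, ← ENNReal.ofReal_inv_of_pos hq0, ← ENNReal.ofReal_inv_of_pos hr0,
      ← ENNReal.ofReal_inv_of_pos two_pos, ← ENNReal.ofReal_add (by positivity) (by positivity)]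
    exact ENNReal.ofReal_le_ofReal h1
  · rw [ENNReal.toReal_inv, ENNReal.toReal_inv, ENNReal.toReal_ofReal hq0.le,
      ENNReal.toReal_ofReal hr0.le, h2]

theorem isWaveAdmissible_energy (κ : ℝ) : IsWaveAdmissible κ 0 ⊤ 2 := by
  refine ⟨by simp, le_rfl, by simp, by simp, by simp; norm_num, fun h => absurd h zero_ne_one⟩

/-- Hölder's inequality in time, with the power of the measure that the exponents leave. -/
theorem lintegral_rpow_le_of_eLpNorm {μ : Measure ℝ} {B : ℝ → ℝ≥0∞} (hB : AEMeasurable B μ)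
    {k ε : ℝ} (hk : 0 < k) (hε : 0 < ε) (hε' : ε < 1) {z : ℝ≥0∞}
    (hz : eLpNorm B (ENNReal.ofReal (k / (1 - ε))) μ ≤ z) :
    ∫⁻ t, B t ^ k ∂μ ≤ z ^ k * μ Set.univ ^ ε := by
  have h1ε : 0 < 1 - ε := by linarith
  have hq : 0 < k / (1 - ε) := by positivity
  -- The exponent 1/(1-ε) falls on B^k and produces the norm of order k/(1-ε); the dual exponent 1/ε
  -- on the constant 1 leaves the measure to the power ε.
  have hc : (1 / (1 - ε)).HolderConjugate (1 / ε) := by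
    rw [Real.holderConjugate_iff]
    refine ⟨?_, by simp⟩
    rw [lt_div_iff₀ h1ε]; linarith
  have h := ENNReal.lintegral_mul_le_Lp_mul_Lq μ hc (f := fun t => B t ^ k) (g := fun _ => 1)
    (hB.pow_const _) aemeasurable_const
  simp only [Pi.mul_apply, mul_one, ENNReal.one_rpow, lintegral_const, one_mul, one_div,
    inv_inv, ← ENNReal.rpow_mul] at h
  refine h.trans ?_
  gcongr
  rw [eLpNorm_eq_lintegral_rpow_enorm_toReal (by simpa using hq) ENNReal.ofReal_ne_top,
    ENNReal.toReal_ofReal hq.le] at hz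
  have h2 := ENNReal.rpow_le_rpow hz hk.le
  rw [← ENNReal.rpow_mul] at h2
  simp only [enorm_eq_self] at h2
  rw [show 1 / (k / (1 - ε)) * k = 1 - ε by field_simp] at h2
  rwa [← div_eq_mul_inv]

theorem ae_lt_top_of_eLpNorm {μ : Measure ℝ} {B : ℝ → ℝ≥0∞} (hB : AEMeasurable B μ)
    {q : ℝ} (hq : 0 < q) (hz : eLpNorm B (ENNReal.ofReal q) μ < ⊤) : ∀ᵐ t ∂μ, B t < ⊤ := by
  have h := lintegral_rpow_enorm_lt_top_of_eLpNorm_lt_top (by simpa using hq)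
    ENNReal.ofReal_ne_top hz
  rw [ENNReal.toReal_ofReal hq.le] at h
  simp only [enorm_eq_self] at h
  filter_upwards [ae_lt_top' (hB.pow_const _) h.ne] with t ht
  by_contra hc
  rw [not_lt_top_iff] at hc
  simp [hc, hq] at ht

/-- Since 1 - θ = (5-p)(p+1)/((p-1)(7-p)), the factor p + 1 cancels. -/
theorem sThreshold_eq {p : ℝ} (hp : 3 ≤ p) (hp' : p < 5) :
    sThreshold p = 1 - (5 - p) ^ 2 / (2 * ((p - 1) * (7 - p))) := by
  have : p - 1 ≠ 0 := by linarith
  have : 7 - p ≠ 0 := by linarith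
  have : p + 1 ≠ 0 := by linarith
  rw [sThreshold, theta]
  field_simp
  ring

theorem sThreshold_nonneg {p : ℝ} (hp : 3 ≤ p) (hp' : p < 5) : 0 ≤ sThreshold p := by
  have h1 : 0 < (p - 1) * (7 - p) := mul_pos (by linarith) (by linarith)
  rw [sThreshold_eq hp hp', sub_nonneg, div_le_one (by positivity)]
  nlinarith

/-- With the closed form of the threshold this reduces to p(5-p) ≤ (p-1)(7-p), that is 3p ≥ 7. -/
theorem mul_one_sub_lt_of_threshold {p s : ℝ} (hp : 3 ≤ p) (hp' : p < 5) (hs : sThreshold p < s) :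
    p * (1 - s) < (5 - p) / 2 := by
  have h1 : 0 < (p - 1) * (7 - p) := mul_pos (by linarith) (by linarith)
  rw [sThreshold_eq hp hp'] at hs
  have h3 : p * (1 - s) < p * ((5 - p) ^ 2 / (2 * ((p - 1) * (7 - p)))) := by
    apply mul_lt_mul_of_pos_left <;> linarith
  refine h3.trans_le ?_
  rw [← mul_div_assoc, div_le_iff₀ (by positivity)]
  nlinarith [mul_nonneg (show 0 ≤ 5 - p by linarith) (show 0 ≤ 3 * p - 7 by linarith)]

/-- The exponent of the time variable for the low frequencies. -/
theorem lowExponent_pos {p ε : ℝ} (hp : 3 ≤ p) (hε : 0 < ε) (hε' : ε < 1) :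
    0 < 1 / 2 - (1 - ε) / (p - 1) ∧ 1 / 2 - (1 - ε) / (p - 1) ≤ 1 / 2 := by
  have h1 : 0 < p - 1 := by linarith
  constructor
  · rw [sub_pos, div_lt_div_iff₀ h1 two_pos]; linarith
  · have : 0 < (1 - ε) / (p - 1) := div_pos (by linarith) h1
    linarith

theorem isWaveAdmissible_low {p ε κ : ℝ} (hp : 3 ≤ p) (hε : 0 < ε) (hε' : ε < 1) :
    IsWaveAdmissible κ (1 - 2 * (1 / 2 - (1 - ε) / (p - 1)))
      (ENNReal.ofReal ((p - 1) / (1 - ε)))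
      (ENNReal.ofReal (1 / 2 - (1 - ε) / (p - 1))⁻¹) := by
  obtain ⟨h1, h2⟩ := lowExponent_pos hp hε hε'
  have h3 : 0 < 1 - ε := by linarith
  refine isWaveAdmissible_ofReal ?_ ?_ ?_ ?_ (by linarith)
  · rw [lt_div_iff₀ h3]; linarith
  · rw [le_inv_comm₀ two_pos h1, ← one_div]; exact h2
  · rw [inv_inv, inv_div]; linarith
  · rw [inv_inv, inv_div]; ring

/-- The term ‖g‖_{2p}^p and Hölder in time dictate r = 2p and q = p/(1-ε); scaling then determines
m. Admissibility amounts to (3/2 - ε)/p ≤ 1/2, which holds for p ≥ 3. -/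
theorem isWaveAdmissible_high {p ε κ : ℝ} (hp : 3 ≤ p) (hε : 0 < ε) (hε' : ε < 1)
    (hb : 0 < ((5 - p) / 2 - ε) / p) :
    IsWaveAdmissible κ (1 - ((5 - p) / 2 - ε) / p) (ENNReal.ofReal (p / (1 - ε)))
      (ENNReal.ofReal (2 * p)) := by
  have hp0 : 0 < p := by linarith
  have h3 : 0 < 1 - ε := by linarith
  refine isWaveAdmissible_ofReal ?_ (by linarith) ?_ ?_ (by linarith)
  · rw [lt_div_iff₀ h3]; linarith
  · rw [inv_div]
    have : (1 - ε) / p + (2 * p)⁻¹ = (3 / 2 - ε) / p := by field_simp; ring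
    rw [this, div_le_iff₀ hp0]; linarith
  · rw [inv_div]; field_simp; ring

/-! ### The space-time estimate -/

/-- The commutator estimate for finite `Z`. -/
theorem exists_lintegral_commutatorNorm_le {p s κ ε : ℝ} {η : R3 → ℝ} (hp : 3 ≤ p)
    (hs : 0 ≤ s) (hs' : s < 1) (hη : IsProfile s η) (hε : 0 < ε) (hε' : ε < 1)
    (hεs : p * (1 - s) < (5 - p) / 2 - ε) :
    ∃ C : ℝ≥0, ∀ N : ℝ, 1 ≤ N → ∀ J : Set ℝ, MeasurableSet J →
      ∀ (w : ℝ → L2) (w' : ℝ → 𝓢'(R3, ℂ)),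
        IsEnergyPath s J (fun t => (w t : 𝓢'(R3, ℂ))) w' →
        Z κ η N J (fun t => (w t : 𝓢'(R3, ℂ))) w' < ⊤ →
        ∫⁻ t in J, commutatorNorm p (symbolI η N) (w t) ≤
          C * (Z κ η N J (fun t => (w t : 𝓢'(R3, ℂ))) w' ^ p * volume J ^ ε *
            ENNReal.ofReal (N ^ (-((5 - p) / 2 - ε)))) := by
  have hp0 : 0 < p := by linarith
  have hp1 : 0 < p - 1 := by linarith
  have h1ε : 0 < 1 - ε := by linarith
  obtain ⟨hα0, hα1⟩ := lowExponent_pos hp hε hε'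
  have hadm₁ := isWaveAdmissible_low (κ := κ) hp hε hε'
  set α : ℝ := 1 / 2 - (1 - ε) / (p - 1) with hα
  have hb₂ : 1 - s < ((5 - p) / 2 - ε) / p := by rw [lt_div_iff₀ hp0]; linarith
  have hb₂0 : 0 < ((5 - p) / 2 - ε) / p := by linarith
  have hb₂1 : ((5 - p) / 2 - ε) / p ≤ 1 := by rw [div_le_one hp0]; linarith
  have hadm₂ := isWaveAdmissible_high (κ := κ) hp hε hε' hb₂0
  have hb₂p : ((5 - p) / 2 - ε) / p * p = (5 - p) / 2 - ε := by field_simp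
  set b₂ : ℝ := ((5 - p) / 2 - ε) / p
  have h3r : 3 / α⁻¹ = 3 * α := by rw [div_inv_eq_mul]
  obtain ⟨C, hC⟩ := exists_commutatorNorm_le (p := p) (b₁ := 2 * α) (r₁ := α⁻¹) (b₂ := b₂)
    (by linarith) hs hs' hη (by rw [one_lt_inv₀ hα0]; linarith) (by rw [h3r]; linarith) hb₂
  refine ⟨2 * C, fun N hN J hJ w w' hw hZ => ?_⟩
  have hN0 : 0 < N := by linarith
  obtain ⟨A, hAc, hA⟩ := hw.exists_continuousOn hη hs (a := 1) zero_le_one le_rfl hN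
  obtain ⟨F₁, hF₁c, hF₁⟩ := hw.exists_continuousOn hη hs (a := 2 * α) (by linarith)
    (by linarith) hN
  obtain ⟨F₂, hF₂c, hF₂⟩ := hw.exists_continuousOn hη hs (a := b₂) hb₂0.le hb₂1 hN
  set z := Z κ η N J (fun t => (w t : 𝓢'(R3, ℂ))) w'
  have zA := eLpNorm_le_Z (w' := w') hJ (m := 0) (by simp) (isWaveAdmissible_energy κ)
    (G := A) (by simpa using hA)
  have z₁ := eLpNorm_le_Z (w' := w') hJ ⟨by linarith, by linarith⟩ hadm₁ (G := F₁)
    (by simpa using hF₁)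
  have z₂ := eLpNorm_le_Z (w' := w') hJ ⟨by linarith, by linarith⟩ hadm₂ (G := F₂)
    (by simpa using hF₂)
  have m₁ := aemeasurable_eLpNorm_of_continuousOn hJ hF₁c (ENNReal.ofReal α⁻¹)
  have m₂ := aemeasurable_eLpNorm_of_continuousOn hJ hF₂c (ENNReal.ofReal (2 * p))
  have i₁ := lintegral_rpow_le_of_eLpNorm m₁ hp1 hε hε' z₁
  have i₂ := lintegral_rpow_le_of_eLpNorm m₂ hp0 hε hε' z₂
  rw [Measure.restrict_apply_univ] at i₁ i₂
  have t₁ := ae_lt_top_of_eLpNorm m₁ (by positivity) (z₁.trans_lt hZ)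
  have t₂ := ae_lt_top_of_eLpNorm m₂ (by positivity) (z₂.trans_lt hZ)
  have tA : ∀ᵐ t ∂volume.restrict J, eLpNorm (A t) 2 volume ≤ z := by
    filter_upwards [ae_le_eLpNormEssSup (f := fun t => eLpNorm (A t) 2 volume)
      (μ := volume.restrict J)] with t ht
    exact ht.trans zA
  set X : ℝ≥0∞ := ENNReal.ofReal (N ^ (-((5 - p) / 2 - ε)))
  -- The exponent of N is -1 + (p-1)(3α - 2α) = -1 + (p-1)/2 - (1-ε) = -((5-p)/2 - ε).
  have e₁ : ENNReal.ofReal N⁻¹ * ENNReal.ofReal (N ^ (3 / α⁻¹ - 2 * α)) ^ (p - 1) = X := by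
    rw [ENNReal.ofReal_rpow_of_nonneg (by positivity) hp1.le, ← Real.rpow_mul hN0.le,
      ← Real.rpow_neg_one, ← ENNReal.ofReal_mul (by positivity), ← Real.rpow_add hN0]
    congr 2
    rw [h3r, hα]
    field_simp
    ring
  have e₂ : ENNReal.ofReal (N ^ (-b₂)) ^ p = X := by
    rw [ENNReal.ofReal_rpow_of_nonneg (by positivity) hp0.le, ← Real.rpow_mul hN0.le, neg_mul,
      hb₂p]
  have pointwise : ∀ᵐ t ∂volume.restrict J, commutatorNorm p (symbolI η N) (w t) ≤
      C * (X * z * eLpNorm (F₁ t) (ENNReal.ofReal α⁻¹) volume ^ (p - 1) +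
        X * eLpNorm (F₂ t) (ENNReal.ofReal (2 * p)) volume ^ p) := by
    filter_upwards [t₁, t₂, tA, ae_restrict_mem hJ] with t h1 h2 h3 ht
    refine (hC N hN0 (w t) (A t) (F₁ t) (F₂ t) (hA t ht) (hF₁ t ht) (hF₂ t ht) h1 h2).trans ?_
    rw [ENNReal.mul_rpow_of_nonneg _ _ hp1.le, ENNReal.mul_rpow_of_nonneg _ _ hp0.le, e₂]
    refine mul_le_mul_right (add_le_add ?_ le_rfl) _
    rw [← e₁]
    calc _ ≤ ENNReal.ofReal N⁻¹ * z * (ENNReal.ofReal (N ^ (3 / α⁻¹ - 2 * α)) ^ (p - 1) *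
          eLpNorm (F₁ t) (ENNReal.ofReal α⁻¹) volume ^ (p - 1)) := by gcongr
      _ = _ := by ring
  have hz : z * z ^ (p - 1) = z ^ p := by
    nth_rewrite 1 [← ENNReal.rpow_one z]
    rw [← ENNReal.rpow_add_of_nonneg _ _ zero_le_one hp1.le, add_sub_cancel]
  calc ∫⁻ t in J, commutatorNorm p (symbolI η N) (w t)
      ≤ ∫⁻ t in J, C * (X * z * eLpNorm (F₁ t) (ENNReal.ofReal α⁻¹) volume ^ (p - 1) +
        X * eLpNorm (F₂ t) (ENNReal.ofReal (2 * p)) volume ^ p) := lintegral_mono_ae pointwise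
    _ = C * (X * z * (∫⁻ t in J, eLpNorm (F₁ t) (ENNReal.ofReal α⁻¹) volume ^ (p - 1)) +
        X * ∫⁻ t in J, eLpNorm (F₂ t) (ENNReal.ofReal (2 * p)) volume ^ p) := by
      rw [lintegral_const_mul' _ _ ENNReal.coe_ne_top,
        lintegral_add_left' ((m₁.pow_const _).const_mul _),
        lintegral_const_mul'' _ (m₁.pow_const _), lintegral_const_mul'' _ (m₂.pow_const _)]
    _ ≤ C * (X * z * (z ^ (p - 1) * volume J ^ ε) + X * (z ^ p * volume J ^ ε)) := by gcongr
    _ = C * (X * (z * z ^ (p - 1)) * volume J ^ ε + X * (z ^ p * volume J ^ ε)) := by ring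
    _ = _ := by
      rw [hz]
      push_cast
      ring

end RoughWave

end

theorem mainTheorem5 (p s κ : ℝ) (hp : 3 ≤ p) (hp' : p < 5)
    (hs : RoughWave.sThreshold p < s) (hs' : s < 1) (hκ : 0 < κ)
    (η : RoughWave.R3 → ℝ) (hη : RoughWave.IsProfile s η) :
    ∃ ε₀ : ℝ, 0 < ε₀ ∧ ∀ ε : ℝ, 0 < ε → ε < ε₀ →
      ∃ C : ℝ≥0, ∀ (N : ℝ), (∃ k : ℕ, N = 2 ^ k) →
        ∀ (J : Set ℝ), J.OrdConnected →
        ∀ (w : ℝ → Lp ℂ 2 (volume : Measure RoughWave.R3)) (w' : ℝ → 𝓢'(RoughWave.R3, ℂ)),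
          RoughWave.IsEnergyPath s J (fun t => (w t : 𝓢'(RoughWave.R3, ℂ))) w' →
          ∫⁻ t in J, RoughWave.commutatorNorm p (RoughWave.symbolI η N) (w t) ≤
            C * RoughWave.Z κ η N J (fun t => (w t : 𝓢'(RoughWave.R3, ℂ))) w' ^ p *
              volume J ^ ε / ENNReal.ofReal (N ^ ((5 - p) / 2 - ε)) := by
  have hs0 : 0 ≤ s := (RoughWave.sThreshold_nonneg hp hp').trans hs.le
  have hgap := RoughWave.mul_one_sub_lt_of_threshold hp hp' hs
  -- The bound 1 is for Hölder in time; the other is the room left by the threshold for b > 1 - s at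
  -- high frequency.
  refine ⟨min 1 ((5 - p) / 2 - p * (1 - s)), lt_min one_pos (by linarith), fun ε hε hε₀ => ?_⟩
  obtain ⟨hε1, hε2⟩ := lt_min_iff.1 hε₀
  obtain ⟨C, hC⟩ := RoughWave.exists_lintegral_commutatorNorm_le (κ := κ) hp hs0 hs' hη hε hε1
    (by linarith)
  -- The added 1 makes the constant nonzero, so that the right-hand side is ∞ when Z = ∞ and |J| >
  -- 0.
  refine ⟨C + 1, fun N ⟨k, hk⟩ J hJ w w' hw => ?_⟩
  have hN : 1 ≤ N := hk ▸ one_le_pow₀ one_le_two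
  have hN0 : 0 < N := by linarith
  have hJm : MeasurableSet J := hJ.measurableSet
  set z := RoughWave.Z κ η N J (fun t => (w t : 𝓢'(RoughWave.R3, ℂ))) w'
  -- Null J is separated because 0·∞ = 0 would make the right-hand side vanish even when Z = ∞.
  rcases eq_or_ne (volume J) 0 with h0 | h0
  · rw [Measure.restrict_eq_zero.2 h0, lintegral_zero_measure]; exact zero_le
  rcases eq_or_ne z ⊤ with hz | hz
  · have h1 : volume J ^ ε ≠ 0 := by simp [h0, hε.le]
    rw [hz, ENNReal.top_rpow_of_pos (by linarith), ENNReal.mul_top (by simp),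
      ENNReal.top_mul h1, ENNReal.top_div_of_ne_top ENNReal.ofReal_ne_top]
    exact le_top
  refine (hC N hN J hJm w w' hw (lt_top_iff_ne_top.2 hz)).trans ?_
  rw [Real.rpow_neg hN0.le, ENNReal.ofReal_inv_of_pos (by positivity), ← div_eq_mul_inv,
    ← mul_div_assoc, ← mul_assoc]
  exact ENNReal.div_le_div_right (mul_le_mul_left (mul_le_mul_left
    (ENNReal.coe_le_coe.2 le_self_add) _) _) _
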